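/- All graphs are finite and loopless and may have multiple edges. A signed graph $(G,\sigma)$ is a graph $G$ with a map $\sigma:E(G)\to\{\pm1\}$. Regard each edge $e$ with ends $u,v$ as two half edges $h_e^u$ and $h_e^v$, incident with $u$ and $v$ respectively. An orientation of $(G,\sigma)$ assigns to each half edge $h$ a value $\tau(h)\in\{\pm1\}$ such that $\tau(h_e^u)\,\tau(h_e^v)=-\sigma(e)$ for every edge $e$ with ends $u,v$. For an integer $k\ge 2$, a nowhere-zero $k$-flow of $(G,\sigma)$ consists of an orientation $\tau$ and a function $f:E(G)\to\mathbb{Z}$ such that $0<|f(e)|<k$ for every edge $e$ and $\sum_{e\ni v}\tau(h_e^v)f(e)=0$ for every vertex $v$. The signed graph is flow-admissible if it has a nowhere-zero $k$-flow for some integer $k\ge2$. A Hamiltonian circuit of $G$ is a connected $2$-regular spanning subgraph of $G$ (for two vertices, a pair of parallel edges), and it is balanced if the product of the signs of its edges is $+1$. **Theorem.** Every flow-admissible signed graph that has a balanced Hamiltonian circuit admits a nowhere-zero $6$-flow. -/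

import Mathlib

namespace SignedFlow

variable {α β : Type*}

/-- The degree of `v` in the multigraph `G`: the number of edges incident with `v`, loops
counted twice. -/
noncomputable def degree (G : Graph α β) (v : α) : ℕ :=
  (G.incidenceSet v).ncard + (G.loopSet v).ncard

/-- A graph is connected if it has a vertex and any two of its vertices are joined by a walk. -/
structure IsConnected (G : Graph α β) : Prop where
  nonempty : G.vertexSet.Nonempty
  joined : ∀ x ∈ G.vertexSet, ∀ y ∈ G.vertexSet, Relation.ReflTransGen G.Adj x y

/-- A circuit is a connected 2-regular graph. (In a multigraph, two parallel edges form a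
circuit of length 2.) -/
structure IsCircuit (C : Graph α β) : Prop where
  connected : IsConnected C
  regular : ∀ v ∈ C.vertexSet, degree C v = 2

/-- A Hamiltonian circuit of `G` is a spanning subgraph of `G` which is a circuit. -/
structure IsHamiltonianCircuit (G C : Graph α β) : Prop where
  spanning : Graph.IsSpanningSubgraph C G
  circuit : IsCircuit C

/-- The sign of a (finite) subgraph: the product of the signs of its edges. -/
noncomputable def subgraphSign (σ : β → ℤˣ) (F : Graph α β) : ℤˣ :=
  ∏ᶠ e ∈ F.edgeSet, σ e

/-- A circuit is balanced if its sign is `+1`. -/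
def IsBalanced (σ : β → ℤˣ) (C : Graph α β) : Prop :=
  subgraphSign σ C = 1

/-- An orientation of the signed (loopless) graph `(G, σ)`. The half edge of `e` at its end `x`
is the pair `(x, e)`; `τ x e = 1` means that it is directed away from `x`, and `τ x e = -1` that
it is directed toward `x`. Values at pairs `(x, e)` that are not half edges play no role. -/
def IsOrientation (G : Graph α β) (σ : β → ℤˣ) (τ : α → β → ℤˣ) : Prop :=
  ∀ e x y, G.IsLink e x y → τ x e * τ y e = -σ e

/-- The boundary of `f` at `v`: the signed sum of `f` over the half edges at `v`. -/
noncomputable def boundary (G : Graph α β) (τ : α → β → ℤˣ) (f : β → ℤ) (v : α) : ℤ :=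
  ∑ᶠ e ∈ G.incidenceSet v, (τ v e : ℤ) * f e

/-- `(τ, f)` is a `k`-flow of the signed graph `(G, σ)`. -/
structure IsFlow (G : Graph α β) (σ : β → ℤˣ) (k : ℕ) (τ : α → β → ℤˣ) (f : β → ℤ) : Prop where
  orientation : IsOrientation G σ τ
  boundary_eq_zero : ∀ v ∈ G.vertexSet, boundary G τ f v = 0
  abs_lt : ∀ e ∈ G.edgeSet, |f e| < (k : ℤ)

/-- `(G, σ)` admits a nowhere-zero `k`-flow: a `k`-flow whose support is the whole edge set. -/
def AdmitsNZF (G : Graph α β) (σ : β → ℤˣ) (k : ℕ) : Prop :=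
  ∃ (τ : α → β → ℤˣ) (f : β → ℤ), IsFlow G σ k τ f ∧ ∀ e ∈ G.edgeSet, f e ≠ 0

/-- `(G, σ)` is flow-admissible if it admits a nowhere-zero `k`-flow for some integer `k ≥ 2`. -/
def FlowAdmissible (G : Graph α β) (σ : β → ℤˣ) : Prop :=
  ∃ k : ℕ, 2 ≤ k ∧ AdmitsNZF G σ k

end SignedFlow

/-! Switching makes every edge of the balanced Hamiltonian circuit positive
(`IsCyclicEnum.exists_switching`); call the other edges chords. Let the `j`-th circuit edge carry `2
* l j - 3` and let a chord carry `2a` up to sign, with `|a|` equal to 1 or 2. If `-1 ≤ l j ≤ 4`,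
circuit values are odd of size at most 5 and chord values have size 2 or 4, so the flow is a
nowhere-zero 6-flow (`admitsNZF_of_levels`). It remains to put values `a` on the chord ends,
opposite at the two ends of a positive chord and equal at those of a negative one, so that the
partial sums around the circuit close up and stay in `[-1, 4]`. Ends at a common vertex may be put
in any order (`exists_levels`), so this is a problem about a sequence of points with a chord
matching `M` (`hasLevels`).

Let `Q` pair consecutive points. Signs `Y` that are opposite on each `Q`-pair have partial sums in
`[-1, 1]` (`exists_pairing`). On each orbit of `M` and `Q` such a `Y` can obey all chord signs
except on at most one negative chord, and it may be negated orbit by orbit (`exists_alternating`). A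
defective chord is repaired by reversing its later end, which shifts all later sums by 2 in a
direction that is free to choose. Alternating these shifts keeps the correction in `{0, 2}`, and it
closes up when the number of defects is even. That number has the parity of the number of negative
chords, which settles the even case (`hasLevels_of_even`).

If the number of negative chords is odd, one chord receives a value of size 2 and the correction may
use all of `[0, 3]`. Either two negative chords cross (`hasLevels_of_crossing`), or after a rotation
some negative chord has the first and the last of the negative ends (`hasLevels_of_consecutive`).
Both cases involve a second negative chord. Flow-admissibility enters only here: it excludes a
single negative edge (`exists_ne_negative_edge`). -/

namespace SignedFlow

/-! ### Pairing consecutive elements -/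

/-- Pair the elements of `U` consecutively. An initial segment then splits at most one pair, and
whole pairs cancel. The induction removes the two largest elements. -/
theorem exists_pairing {ι : Type*} [LinearOrder ι] (U : Finset ι) (hU : Even U.card) :
    ∃ Q : ι → ι, (∀ i ∈ U, Q i ∈ U ∧ Q (Q i) = i ∧ Q i ≠ i) ∧
      ∀ Y : ι → ℤ, (∀ i ∈ U, Y i = 1 ∨ Y i = -1) → (∀ i ∈ U, Y (Q i) = -Y i) →
        ∑ i ∈ U, Y i = 0 ∧ ∀ P : ι → Prop, [DecidablePred P] → (∀ i j, i ≤ j → P j → P i) →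
          -1 ≤ ∑ i ∈ U with P i, Y i ∧ ∑ i ∈ U with P i, Y i ≤ 1 := by
  obtain ⟨c, hc⟩ := hU
  induction c generalizing U with
  | zero =>
    have : U = ∅ := by simpa using hc
    subst this
    exact ⟨id, by simp, by simp⟩
  | succ c ih =>
    have hne : U.Nonempty := by rw [← Finset.card_pos]; omega
    set y := U.max' hne with hy
    have hyU : y ∈ U := U.max'_mem hne
    have hcard1 : (U.erase y).card = c + c + 1 := by rw [Finset.card_erase_of_mem hyU]; omega
    have hne1 : (U.erase y).Nonempty := by rw [← Finset.card_pos]; omega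
    set x := (U.erase y).max' hne1 with hx
    have hxU1 : x ∈ U.erase y := (U.erase y).max'_mem hne1
    have hxU : x ∈ U := Finset.mem_of_mem_erase hxU1
    have hxy : x ≠ y := Finset.ne_of_mem_erase hxU1
    have hlt : x < y := lt_of_le_of_ne (U.le_max' x hxU) hxy
    set V := (U.erase y).erase x with hV
    have hcard2 : V.card = c + c := by rw [hV, Finset.card_erase_of_mem hxU1]; omega
    have hUV : U = insert y (insert x V) := by
      rw [hV, Finset.insert_erase hxU1, Finset.insert_erase hyU]
    have hxV : x ∉ V := by simp [hV]
    have hyV : y ∉ insert x V := by simp [hV, hxy.symm]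
    have hVx : ∀ i ∈ V, i < x := fun i hi =>
      lt_of_le_of_ne ((U.erase y).le_max' i (Finset.mem_of_mem_erase hi)) (Finset.ne_of_mem_erase hi)
    obtain ⟨Q, hQ, hsum⟩ := ih V hcard2
    refine ⟨fun i => if i = x then y else if i = y then x else Q i, ?_, ?_⟩
    · intro i hi
      by_cases h1 : i = x
      · subst h1; simp [hxy.symm, hyU]
      by_cases h2 : i = y
      · subst h2; simp [hxy.symm, hxy, hxU]
      have hiV : i ∈ V := by rw [hUV] at hi; simpa [h1, h2] using hi
      obtain ⟨a, b, c⟩ := hQ i hiV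
      have h3 : Q i ≠ x := fun h => hxV (h ▸ a)
      have h4 : Q i ≠ y := fun h => hyV (h ▸ Finset.mem_insert_of_mem a)
      simp only [h1, h2, h3, h4, if_false]
      refine ⟨?_, b, c⟩
      rw [hUV]; exact Finset.mem_insert_of_mem (Finset.mem_insert_of_mem a)
    · intro Y hY hYQ
      have hYx := hY x hxU
      have hyx : Y y = -Y x := by simpa using hYQ x hxU
      obtain ⟨s0, s1⟩ := hsum Y (fun i hi => hY i (by rw [hUV]; simp [hi])) (fun i hi => by
        have h := hYQ i (by rw [hUV]; simp [hi])
        have h1 : i ≠ x := fun h => hxV (h ▸ hi)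
        have h2 : i ≠ y := fun h => hyV (h ▸ Finset.mem_insert_of_mem hi)
        simpa [h1, h2] using h)
      rw [hUV]
      refine ⟨?_, ?_⟩
      · rw [Finset.sum_insert hyV, Finset.sum_insert hxV, s0, hyx]; ring
      · intro P _ hP
        by_cases hPx : P x
        · have hall : V.filter P = V :=
            Finset.filter_true_of_mem fun i hi => hP i x (hVx i hi).le hPx
          by_cases hPy : P y
          · rw [Finset.filter_insert, if_pos hPy, Finset.filter_insert, if_pos hPx, hall,
              Finset.sum_insert hyV, Finset.sum_insert hxV, s0, hyx]
            constructor <;> linarith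
          · rw [Finset.filter_insert, if_neg hPy, Finset.filter_insert, if_pos hPx, hall,
              Finset.sum_insert hxV, s0]
            rcases hYx with h | h <;> rw [h] <;> norm_num
        · have hPy : ¬ P y := fun h => hPx (hP x y hlt.le h)
          rw [Finset.filter_insert, if_neg hPy, Finset.filter_insert, if_neg hPx]
          exact s1 P hP

/-! ### Orbits of two involutions -/

section Orbits

variable {ι : Type*}

/-- Two points are linked if they lie in the same orbit of the maps `M` and `Q`. -/
def linked (M Q : ι → ι) : Setoid ι :=
  Relation.EqvGen.setoid fun x y => y = M x ∨ y = Q x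

theorem linked_left (M Q : ι → ι) (i : ι) : linked M Q i (M i) :=
  Relation.EqvGen.rel _ _ (Or.inl rfl)

theorem linked_right (M Q : ι → ι) (i : ι) : linked M Q i (Q i) :=
  Relation.EqvGen.rel _ _ (Or.inr rfl)

/-- The characteristic function of the pair `{i, M i}`. -/
def pairChar [DecidableEq ι] (M : ι → ι) (i k : ι) : ZMod 2 :=
  (if k = i then 1 else 0) + (if k = M i then 1 else 0)

theorem zmod_two_add_self (x : ZMod 2) : x + x = 0 := CharTwo.add_self_eq_zero x

/-- `F` is the sum mod 2 of the indicators of the `Q`-pairs used on a path from `i` to `j`; steps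
along `M` cost nothing because both ends have the same `pairChar`. -/
theorem exists_flip [DecidableEq ι] {M Q : ι → ι} (hM : Function.Involutive M)
    (hQ : Function.Involutive Q) {i j : ι} (h : linked M Q i j) :
    ∃ F : ι → ZMod 2, (∀ k, F (Q k) = F k) ∧
      ∀ k, F (M k) + F k = pairChar M i k + pairChar M j k := by
  have h' : Relation.EqvGen (fun x y => y = M x ∨ y = Q x) i j := h
  induction h' with
  | rel x y hxy =>
    rcases hxy with rfl | rfl
    · refine ⟨0, by simp, fun k => ?_⟩
      simp only [pairChar, hM x, Pi.zero_apply]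
      generalize (if k = x then (1 : ZMod 2) else 0) = s
      generalize (if k = M x then (1 : ZMod 2) else 0) = t
      revert s t; decide
    · refine ⟨fun k => (if k = x then 1 else 0) + (if k = Q x then 1 else 0), fun k => ?_,
        fun k => ?_⟩
      · have e1 : Q k = x ↔ k = Q x := ⟨fun h => by rw [← h, hQ], fun h => by rw [h, hQ]⟩
        have e2 : Q k = Q x ↔ k = x := hQ.injective.eq_iff
        simp only [e1, e2]; ring
      · have e1 : ∀ z, M k = z ↔ k = M z := fun z =>
          ⟨fun h => by rw [← h, hM], fun h => by rw [h, hM]⟩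
        simp only [pairChar, e1]; ring
  | refl x => exact ⟨0, by simp, fun k => by simp [zmod_two_add_self]⟩
  | symm x y _ ih =>
    obtain ⟨F, h1, h2⟩ := ih ‹_›
    exact ⟨F, h1, fun k => by rw [h2, add_comm]⟩
  | trans x y z h1 h2 ih1 ih2 =>
    obtain ⟨F, a1, a2⟩ := ih1 h1
    obtain ⟨F', b1, b2⟩ := ih2 h2
    refine ⟨F + F', fun k => by simp [a1, b1], fun k => ?_⟩
    have := a2 k
    have := b2 k
    simp only [Pi.add_apply]
    have e : F (M k) + F' (M k) + (F k + F' k) = (F (M k) + F k) + (F' (M k) + F' k) := by ring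
    rw [e, a2, b2]
    have := zmod_two_add_self (pairChar M y k)
    linear_combination this

/-- The points at which `Y` violates the relation `Y (M i) = Y i + ε i`. -/
def defect (M : ι → ι) (ε Y : ι → ZMod 2) (i : ι) : ZMod 2 := Y (M i) + Y i + ε i

/-- Minimise the number of defects outside `D`. If a defective `i` outside `D` shares its orbit with
another defect or with a point of `D`, adding the `F` of `exists_flip` clears the defect at `i` and
toggles it only on the other chord. Defects inside `D` are not counted, so `D` serves as a sink. -/
theorem exists_minimal_defect [Fintype ι] [DecidableEq ι] {M Q : ι → ι}
    (hM : Function.Involutive M) (hM' : ∀ i, M i ≠ i) (hQ : Function.Involutive Q)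
    (ε : ι → ZMod 2) (hε : ∀ i, ε (M i) = ε i) (N D : Finset ι) (hN : ∀ i ∈ N, M i ∈ N)
    (hDN : D ⊆ N) (hD : ∀ i ∈ D, M i ∈ D) (Y₀ : ι → ZMod 2) (hY₀ : ∀ i, Y₀ (Q i) = Y₀ i + 1)
    (hN₀ : ∀ i, defect M ε Y₀ i ≠ 0 → i ∈ N) :
    ∃ Y : ι → ZMod 2, (∀ i, Y (Q i) = Y i + 1) ∧ (∀ i, defect M ε Y i ≠ 0 → i ∈ N) ∧
      ∀ i, i ∉ D → defect M ε Y i ≠ 0 → ∀ j, linked M Q i j →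
        j ∉ D ∧ (defect M ε Y j ≠ 0 → j = i ∨ j = M i) := by
  induction hc : (Finset.univ.filter fun i => i ∉ D ∧ defect M ε Y₀ i ≠ 0).card
    using Nat.strong_induction_on generalizing Y₀ with
  | _ c ih =>
  by_contra hcon
  push Not at hcon
  obtain ⟨i, hiD, hi, j, hij, hj⟩ := hcon Y₀ hY₀ hN₀
  have hji : j ≠ i ∧ j ≠ M i ∧ (j ∉ D → defect M ε Y₀ j ≠ 0) := by
    by_cases h : j ∈ D
    · refine ⟨fun e => hiD (e ▸ h), fun e => hiD ?_, fun h' => absurd h h'⟩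
      have := hD _ (e ▸ h)
      rwa [hM i] at this
    · exact ⟨(hj h).2.1, (hj h).2.2, fun _ => (hj h).1⟩
  have hjN : j ∈ N := by
    by_cases h : j ∈ D
    · exact hDN h
    · exact hN₀ j (hji.2.2 h)
  obtain ⟨F, hF1, hF2⟩ := exists_flip hM hQ hij
  have hdef : ∀ k, defect M ε (Y₀ + F) k = defect M ε Y₀ k + (pairChar M i k + pairChar M j k) := by
    intro k
    rw [← hF2]; simp only [defect, Pi.add_apply]; ring
  have hsymm : ∀ k, defect M ε Y₀ (M k) = defect M ε Y₀ k := by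
    intro k; simp only [defect, hM k, hε]; ring
  have hone : ∀ x : ZMod 2, x ≠ 0 → x = 1 := by decide
  have hchar : ∀ l k, k ≠ l → k ≠ M l → pairChar M l k = 0 := by
    intro l k h1 h2; simp [pairChar, h1, h2]
  have hkey : ∀ k, k ∉ D → defect M ε (Y₀ + F) k ≠ 0 →
      defect M ε Y₀ k ≠ 0 ∧ k ≠ i := by
    intro k hkD hk
    rw [hdef] at hk
    by_cases h1 : k = i ∨ k = M i
    · exfalso
      have hk0 : defect M ε Y₀ k = 1 := by
        rcases h1 with rfl | rfl
        · exact hone _ hi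
        · rw [hsymm]; exact hone _ hi
      have hkj : k ≠ j ∧ k ≠ M j := by
        refine ⟨fun e => ?_, fun e => ?_⟩
        · rcases h1 with h | h
          · exact hji.1 (e ▸ h)
          · exact hji.2.1 (e ▸ h)
        · have e' : j = M k := by rw [e, hM]
          rcases h1 with h | h
          · exact hji.2.1 (by rw [e', h])
          · exact hji.1 (by rw [e', h, hM])
      apply hk
      rw [hk0, hchar j k hkj.1 hkj.2]
      have hMi := hM' i
      rcases h1 with rfl | rfl
      · simp [pairChar, Ne.symm hMi]; decide
      · simp [pairChar, hMi]; decide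
    · push Not at h1
      rw [hchar i k h1.1 h1.2, zero_add] at hk
      refine ⟨?_, h1.1⟩
      by_cases h2 : k = j ∨ k = M j
      · have hjD : j ∉ D := by
          rcases h2 with h | h
          · exact h ▸ hkD
          · intro h'; exact hkD (h ▸ hD j h')
        rcases h2 with h | h
        · rw [h]; exact hji.2.2 hjD
        · rw [h, hsymm]; exact hji.2.2 hjD
      · push Not at h2
        rwa [hchar j k h2.1 h2.2, add_zero] at hk
  have hlt : (Finset.univ.filter fun k => k ∉ D ∧ defect M ε (Y₀ + F) k ≠ 0).card < c := by
    rw [← hc]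
    refine Finset.card_lt_card ⟨fun k hk => ?_, fun h => ?_⟩
    · simp only [Finset.mem_filter, Finset.mem_univ, true_and] at hk ⊢
      exact ⟨hk.1, (hkey k hk.1 hk.2).1⟩
    · have := h (show i ∈ _ by simp [hiD, hi])
      simp only [Finset.mem_filter, Finset.mem_univ, true_and] at this
      exact (hkey i this.1 this.2).2 rfl
  obtain ⟨Y, hY1, hY2, hY3⟩ := ih _ hlt (Y₀ + F) (fun k => by
    simp only [Pi.add_apply, hY₀, hF1]; ring) (fun k hk => by
    by_cases h1 : k = i ∨ k = M i
    · rcases h1 with rfl | rfl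
      · exact hN₀ _ hi
      · exact hN _ (hN₀ _ hi)
    by_cases h2 : k = j ∨ k = M j
    · rcases h2 with rfl | rfl
      · exact hjN
      · exact hN _ hjN
    push Not at h1 h2
    rw [hdef, hchar i k h1.1 h1.2, hchar j k h2.1 h2.2, add_zero, add_zero] at hk
    exact hN₀ k hk) rfl
  obtain ⟨i', hi'D, hi', j', hij', hj'⟩ := hcon Y hY1 hY2
  obtain ⟨h1, h2⟩ := hY3 i' hi'D hi' j' hij'
  obtain ⟨h3, h4, h5⟩ := hj' h1
  rcases h2 h3 with h | h
  · exact h4 h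
  · exact h5 h

/-- The sign `±1` attached to a bit. -/
def bitSign (x : ZMod 2) : ℤ := if x = 0 then 1 else -1

theorem bitSign_add_one : ∀ x, bitSign (x + 1) = -bitSign x := by decide

theorem bitSign_eq : ∀ x, bitSign x = 1 ∨ bitSign x = -1 := by decide

theorem sum_eq_zero_of_involution {M : ι → ι} (S : Finset ι) (f : ι → ℤ)
    (hM : Function.Involutive M) (hM' : ∀ i, M i ≠ i) (hS : ∀ i ∈ S, M i ∈ S)
    (hf : ∀ i ∈ S, f (M i) = -f i) : ∑ i ∈ S, f i = 0 :=
  Finset.sum_involution (fun i _ => M i) (fun i hi => by rw [hf i hi]; ring)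
    (fun i _ _ => hM' i) (fun i hi => hS i hi) (fun i _ => hM i)

/-- The union of two perfect matchings is bipartite. -/
theorem exists_common_coloring [Fintype ι] [LinearOrder ι] {M Q : ι → ι}
    (hM : Function.Involutive M) (hM' : ∀ i, M i ≠ i) (hQ : Function.Involutive Q)
    (hQ' : ∀ i, Q i ≠ i) :
    ∃ Y : ι → ZMod 2, (∀ i, Y (Q i) = Y i + 1) ∧ ∀ i, Y (M i) = Y i + 1 := by
  classical
  obtain ⟨Y, hY1, -, hY3⟩ := exists_minimal_defect hM hM' hQ 1 (fun _ => rfl) Finset.univ ∅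
    (by simp) (by simp) (by simp) (fun i => if i < Q i then 0 else 1) (fun i => by
      have h := hQ' i
      rw [hQ i]
      rcases lt_or_gt_of_ne h with h | h
      · simp [h, h.not_gt]; decide
      · simp [h, h.not_gt]) (by simp)
  refine ⟨Y, hY1, fun i => ?_⟩
  by_contra hi
  have hd : ∀ k, defect M 1 Y k ≠ 0 ↔ Y (M k) ≠ Y k + 1 := fun k => by
    have : ∀ a b : ZMod 2, a + b + 1 ≠ 0 ↔ a ≠ b + 1 := by decide
    exact this _ _
  have h3 := hY3 i (by simp) ((hd i).2 hi)
  set S := Finset.univ.filter fun j => linked M Q i j with hS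
  have hSM : ∀ j ∈ S, M j ∈ S := fun j hj => by
    simp only [hS, Finset.mem_filter, Finset.mem_univ, true_and] at hj ⊢
    exact (linked M Q).trans hj (linked_left M Q j)
  have hSQ : ∀ j ∈ S, Q j ∈ S := fun j hj => by
    simp only [hS, Finset.mem_filter, Finset.mem_univ, true_and] at hj ⊢
    exact (linked M Q).trans hj (linked_right M Q j)
  have hiS : i ∈ S := by simp [hS]
  have h0 : ∑ j ∈ S, bitSign (Y j) = 0 := sum_eq_zero_of_involution S _ hQ hQ' hSQ fun j _ => by
    rw [hY1, bitSign_add_one]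
  -- The orbit has sign sum zero by `Q`, and so has its part outside the only defective pair by `M`.
  -- The two equal signs of that pair would contribute `±2`.
  have h1 : ∑ j ∈ (S.erase i).erase (M i), bitSign (Y j) = 0 := by
    refine sum_eq_zero_of_involution _ _ hM hM' (fun j hj => ?_) fun j hj => ?_
    · simp only [Finset.mem_erase] at hj ⊢
      refine ⟨fun e => hj.2.1 (hM.injective e), fun e => hj.1 (by rw [← e, hM]), hSM j hj.2.2⟩
    · simp only [Finset.mem_erase] at hj
      have hj' : Y (M j) = Y j + 1 := by
        by_contra h
        have hl : linked M Q i j := by simpa [hS] using hj.2.2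
        rcases (h3 j hl).2 ((hd j).2 h) with h | h
        · exact hj.2.1 h
        · exact hj.1 h
      rw [hj', bitSign_add_one]
  rw [← Finset.add_sum_erase S _ hiS,
    ← Finset.add_sum_erase (S.erase i) _ (Finset.mem_erase.2 ⟨hM' i, hSM i hiS⟩), h1] at h0
  have : ∀ a b : ZMod 2, a ≠ b + 1 → bitSign b + (bitSign a + 0) ≠ 0 := by decide
  exact this _ _ hi h0

theorem even_card_of_sum_eq_zero (S : Finset ι) (f : ι → ℤ) (hf : ∀ i, f i = 1 ∨ f i = -1)
    (h : ∑ i ∈ S, f i = 0) : Even S.card := by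
  have h2 : ((∑ i ∈ S, f i : ℤ) : ZMod 2) = (S.card : ZMod 2) := by
    push_cast
    rw [Finset.card_eq_sum_ones]
    push_cast
    refine Finset.sum_congr rfl fun i _ => ?_
    rcases hf i with h | h <;> rw [h] <;> simp
  rw [h] at h2
  exact (ZMod.natCast_eq_zero_iff_even).1 (by simpa using h2.symm)

/-- `T` collects the ends of the defective chords and `H` selects one end of each chord. `D` is
empty or the chord of `p`; in the latter case the orbit of `p` has no defect except possibly `D`.
The parity holds because the signs on `N \ T` sum to zero and agree along chords, so the number of
these chords is even. Each orbit has at most one point of `H` in `T ∪ D`, so the signs there can be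
prescribed by negating whole orbits. -/
theorem exists_alternating [Fintype ι] [LinearOrder ι] {M Q : ι → ι}
    (hM : Function.Involutive M) (hM' : ∀ i, M i ≠ i) (hQ : Function.Involutive Q)
    (hQ' : ∀ i, Q i ≠ i) (N D H : Finset ι) (hN : ∀ i ∈ N, M i ∈ N) (hDN : D ⊆ N)
    (p : ι) (hDp : ∀ i ∈ D, i = p ∨ i = M p) (hD : ∀ i ∈ D, M i ∈ D)
    (hH : ∀ i, M i ∈ H ↔ i ∉ H) :
    ∃ T ⊆ N, (∀ i ∈ T, M i ∈ T) ∧ Even ((N ∩ H).card + (T ∩ H).card) ∧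
      (∀ i ∈ T, i ∉ D → ∀ j ∈ D, ¬ linked M Q i j) ∧
      ∀ σ : ι → ℤ, (∀ i, σ i = 1 ∨ σ i = -1) → ∃ Y : ι → ℤ, (∀ i, Y i = 1 ∨ Y i = -1) ∧
        (∀ i, Y (Q i) = -Y i) ∧ (∀ i ∈ N, i ∉ T → Y (M i) = Y i) ∧
        (∀ i, (i ∈ N → i ∈ T) → Y (M i) = -Y i) ∧ ∀ i ∈ H, i ∈ T ∪ D → Y i = σ i := by
  classical
  obtain ⟨Y₀, hY₀, hY₀M⟩ := exists_common_coloring hM hM' hQ hQ'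
  have hMN : ∀ i, M i ∈ N ↔ i ∈ N := fun i => ⟨fun h => hM i ▸ hN _ h, hN i⟩
  obtain ⟨Y, hYQ, hYN, hY⟩ := exists_minimal_defect hM hM' hQ
    (fun i => if i ∈ N then 0 else 1) (fun i => by simp only [hMN]) N D hN hDN hD Y₀ hY₀
    (fun i hi => by
      by_contra h
      apply hi
      simp only [defect, hY₀M, h, if_false]
      generalize Y₀ i = x
      revert x; decide)
  set ε : ι → ZMod 2 := fun i => if i ∈ N then 0 else 1 with hε
  set T := Finset.univ.filter fun i => defect M ε Y i ≠ 0 with hT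
  have hsymm : ∀ k, defect M ε Y (M k) = defect M ε Y k := by
    intro k; simp only [defect, hM k, hε, hMN]; ring
  have hTN : T ⊆ N := fun i hi => hYN i (by simpa [hT] using hi)
  have hTM : ∀ i ∈ T, M i ∈ T := fun i hi => by
    simp only [hT, Finset.mem_filter, Finset.mem_univ, true_and, hsymm] at hi ⊢
    exact hi
  have hrel1 : ∀ i ∈ N, i ∉ T → Y (M i) = Y i := fun i hi hiT => by
    simp only [hT, Finset.mem_filter, Finset.mem_univ, true_and, not_not, defect, hε, hi,
      if_true, add_zero] at hiT
    have : ∀ a b : ZMod 2, a + b = 0 → a = b := by decide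
    exact this _ _ hiT
  have hrel2 : ∀ i, (i ∈ N → i ∈ T) → Y (M i) = Y i + 1 := fun i hi => by
    by_cases h : i ∈ N
    · have hiT := hi h
      simp only [hT, Finset.mem_filter, Finset.mem_univ, true_and, defect, hε, h,
        if_true, add_zero] at hiT
      have : ∀ a b : ZMod 2, a + b ≠ 0 → a = b + 1 := by decide
      exact this _ _ hiT
    · have hiT : i ∉ T := fun h' => h (hTN h')
      simp only [hT, Finset.mem_filter, Finset.mem_univ, true_and, not_not, defect, hε, h,
        if_false] at hiT
      have : ∀ a b : ZMod 2, a + b + 1 = 0 → a = b + 1 := by decide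
      exact this _ _ hiT
  refine ⟨T, hTN, hTM, ?_, fun i hi hiD j hj hij =>
    (hY i hiD (by simpa [hT] using hi) j hij).1 hj, fun σ hσ => ?_⟩
  · have h0 : ∑ i, bitSign (Y i) = 0 :=
      sum_eq_zero_of_involution _ _ hQ hQ' (by simp) fun j _ => by rw [hYQ, bitSign_add_one]
    have h1 : ∑ i ∈ Finset.univ \ (N \ T), bitSign (Y i) = 0 := by
      refine sum_eq_zero_of_involution _ _ hM hM' (fun i hi => ?_) fun i hi => ?_
      · simp only [Finset.mem_sdiff, Finset.mem_univ, true_and, not_and, not_not, hMN] at hi ⊢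
        exact fun h => hTM i (hi h)
      · rw [hrel2 i (by simpa using hi), bitSign_add_one]
    have h2 : ∑ i ∈ N \ T, bitSign (Y i) = 0 := by
      rw [← Finset.sum_sdiff (Finset.subset_univ (N \ T)), h1, zero_add] at h0
      exact h0
    have h3 : ∑ i ∈ (N \ T) \ H, bitSign (Y i) = ∑ i ∈ (N \ T) ∩ H, bitSign (Y i) := by
      refine Finset.sum_nbij' M M (fun i hi => ?_) (fun i hi => ?_) (fun i _ => hM i)
        (fun i _ => hM i) fun i hi => ?_
      · simp only [Finset.mem_sdiff, Finset.mem_inter] at hi ⊢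
        exact ⟨⟨hN i hi.1.1, fun h => hi.1.2 (hM i ▸ hTM _ h)⟩, (hH i).2 hi.2⟩
      · simp only [Finset.mem_sdiff, Finset.mem_inter] at hi ⊢
        exact ⟨⟨hN i hi.1.1, fun h => hi.1.2 (hM i ▸ hTM _ h)⟩,
          fun h => ((hH i).1 h) hi.2⟩
      · simp only [Finset.mem_sdiff] at hi
        rw [hrel1 i hi.1.1 hi.1.2]
    have h4 : ∑ i ∈ (N \ T) ∩ H, bitSign (Y i) = 0 := by
      have := Finset.sum_inter_add_sum_sdiff (N \ T) H fun i => bitSign (Y i)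
      linarith
    have h5 := even_card_of_sum_eq_zero _ _ (fun i => bitSign_eq (Y i)) h4
    have h6 : ((N \ T) ∩ H).card + (T ∩ H).card = (N ∩ H).card := by
      rw [← Finset.card_union_of_disjoint, ← Finset.union_inter_distrib_right,
        Finset.sdiff_union_of_subset hTN]
      refine Finset.disjoint_left.2 fun i hi hi' => ?_
      simp only [Finset.mem_inter, Finset.mem_sdiff] at hi hi'
      exact hi.1.2 hi'.1
    rw [← h6, add_assoc]
    exact h5.add (Even.add_self _)
  · have hinj : ∀ i j : {i // i ∈ H ∧ i ∈ T ∪ D}, linked M Q i j → i = j := by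
      have key : ∀ i j, i ∈ H → j ∈ H → i ∈ T ∪ D → j ∈ T ∪ D → i ∉ D → linked M Q i j →
          i = j := by
        intro i j hi hj hiT hjT hiD hij
        have hiT' : i ∈ T := by simpa [hiD] using hiT
        obtain ⟨h1, h2⟩ := hY i hiD (by simpa [hT] using hiT') j hij
        have hjT' : j ∈ T := by simpa [h1] using hjT
        rcases h2 (by simpa [hT] using hjT') with h | h
        · exact h.symm
        · exact absurd hi ((hH i).1 (h ▸ hj))
      rintro ⟨i, hi, hiT⟩ ⟨j, hj, hjT⟩ hij
      simp only [Subtype.mk.injEq]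
      change linked M Q i j at hij
      by_cases hiD : i ∈ D
      · by_cases hjD : j ∈ D
        · rcases hDp i hiD with h | h <;> rcases hDp j hjD with h' | h'
          · rw [h, h']
          · rw [h'] at hj; rw [h] at hi; exact absurd hi ((hH p).1 hj)
          · rw [h'] at hj; rw [h] at hi; exact absurd hj ((hH p).1 hi)
          · rw [h, h']
        · exact (key j i hj hi hjT hiT hjD ((linked M Q).symm hij)).symm
      · exact key i j hi hj hiT hjT hiD hij
    let g : {i // i ∈ H ∧ i ∈ T ∪ D} → Quotient (linked M Q) := fun i => Quotient.mk _ i.1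
    have hg : Function.Injective g := fun i j hij => hinj i j (Quotient.exact hij)
    -- The correction is constant on orbits. Orbits without a prescribed point get the default 0.
    let κ : ι → ZMod 2 := fun k => Function.extend g
      (fun r => Y r.1 + (if σ r.1 = 1 then 0 else 1)) 0 (Quotient.mk (linked M Q) k)
    have hκM : ∀ k, κ (M k) = κ k := fun k => by
      have : Quotient.mk (linked M Q) (M k) = Quotient.mk _ k :=
        (Quotient.sound (linked_left M Q k)).symm
      simp only [κ, this]
    have hκQ : ∀ k, κ (Q k) = κ k := fun k => by
      have : Quotient.mk (linked M Q) (Q k) = Quotient.mk _ k :=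
        (Quotient.sound (linked_right M Q k)).symm
      simp only [κ, this]
    refine ⟨fun i => bitSign (Y i + κ i), fun i => bitSign_eq _, fun i => ?_, fun i hi hiT => ?_,
      fun i hi => ?_, fun i hi hiT => ?_⟩
    · simp only [hκQ, hYQ, ← bitSign_add_one]; congr 1; ring
    · simp only [hκM, hrel1 i hi hiT]
    · simp only [hκM, hrel2 i hi, ← bitSign_add_one]; congr 1; ring
    · have : κ i = Y i + (if σ i = 1 then 0 else 1) := hg.extend_apply _ _ ⟨i, hi, hiT⟩
      simp only [this, ← add_assoc, zmod_two_add_self, zero_add]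
      rcases hσ i with h | h <;> rw [h] <;> decide

end Orbits

/-! ### Levels along a cyclic sequence of half edges -/

/-- `M` matches the points of a cyclic sequence into chords, `N` is the set of ends of negative
chords. Nonzero values `a` of size at most `2` are put on the chords so that the partial sums stay
in an interval of length `5`. -/
def HasLevels {n : ℕ} (M : Fin n → Fin n) (N : Finset (Fin n)) : Prop :=
  ∃ (a : Fin n → ℤ) (l : ℕ → ℤ), (∀ i : Fin n, l (i + 1) = l i + a i) ∧ l n = l 0 ∧
    (∀ k ≤ n, -1 ≤ l k ∧ l k ≤ 4) ∧ (∀ i ∈ N, a (M i) = a i) ∧ (∀ i ∉ N, a (M i) = -a i) ∧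
    ∀ i, |a i| = 1 ∨ |a i| = 2

/-- The number of points of `S` before position `k`. -/
def countBefore {n : ℕ} (S : Finset (Fin n)) (k : ℕ) : ℤ :=
  (S.filter fun i : Fin n => (i : ℕ) < k).card

section CountBefore

variable {n : ℕ} (S : Finset (Fin n))

theorem countBefore_zero : countBefore S 0 = 0 := by simp [countBefore]

theorem countBefore_top : countBefore S n = S.card := by
  simp [countBefore]

theorem countBefore_succ (i : Fin n) :
    countBefore S (i + 1) = countBefore S i + if i ∈ S then 1 else 0 := by
  unfold countBefore
  split_ifs with h
  · have : (S.filter fun j : Fin n => (j : ℕ) < (i : ℕ) + 1) =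
        insert i (S.filter fun j : Fin n => (j : ℕ) < (i : ℕ)) := by
      ext j
      simp only [Finset.mem_filter, Finset.mem_insert, Fin.ext_iff]
      constructor
      · rintro ⟨h1, h2⟩
        by_cases h3 : (j : ℕ) = i
        · exact Or.inl h3
        · exact Or.inr ⟨h1, by omega⟩
      · rintro (h1 | ⟨h1, h2⟩)
        · have : j = i := Fin.ext h1
          exact ⟨this ▸ h, by omega⟩
        · exact ⟨h1, by omega⟩
    rw [this, Finset.card_insert_of_notMem (by simp)]
    push_cast; ring
  · have : (S.filter fun j : Fin n => (j : ℕ) < (i : ℕ) + 1) =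
        S.filter fun j : Fin n => (j : ℕ) < (i : ℕ) := by
      refine Finset.filter_congr fun j hj => ?_
      have : (j : ℕ) ≠ i := fun e => h (Fin.ext e ▸ hj)
      omega
    rw [this]; ring

theorem countBefore_insert {S : Finset (Fin n)} {i : Fin n} (hi : i ∉ S) (k : ℕ) :
    countBefore (insert i S) k = countBefore S k + if (i : ℕ) < k then 1 else 0 := by
  unfold countBefore
  rw [Finset.filter_insert]
  split_ifs with h
  · rw [Finset.card_insert_of_notMem (by simp [hi])]; push_cast; ring
  · ring

end CountBefore

/-- The interval `[-1, 4]` is `[-1, 1]`, from the paired signs, plus `[0, 3]`, the range allowed to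
a correction `E`. Points outside `U` contribute through `E` alone. -/
theorem exists_pairing_levels {n : ℕ} (U : Finset (Fin n)) (hU : Even U.card) :
    ∃ Q : Fin n → Fin n, (∀ i ∈ U, Q i ∈ U ∧ Q (Q i) = i ∧ Q i ≠ i) ∧
      ∀ Y : Fin n → ℤ, (∀ i, Y i = 1 ∨ Y i = -1) → (∀ i ∈ U, Y (Q i) = -Y i) →
        ∀ (E : ℕ → ℤ) (a : Fin n → ℤ), E n = E 0 → (∀ k ≤ n, 0 ≤ E k ∧ E k ≤ 3) →
          (∀ i : Fin n, a i = (if i ∈ U then Y i else 0) + (E (i + 1) - E i)) →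
          ∃ l : ℕ → ℤ, (∀ i : Fin n, l (i + 1) = l i + a i) ∧ l n = l 0 ∧
            ∀ k ≤ n, -1 ≤ l k ∧ l k ≤ 4 := by
  obtain ⟨Q, hQ, h⟩ := exists_pairing U hU
  refine ⟨Q, hQ, fun Y hY hYQ E a hE hE' ha => ?_⟩
  obtain ⟨h0, h1⟩ := h Y (fun i _ => hY i) hYQ
  refine ⟨fun k => ∑ i ∈ U with i.val < k, Y i + E k, fun i => ?_, ?_, fun k hk => ?_⟩
  · have : ∑ j ∈ U with j.val < i.val + 1, Y j =
        ∑ j ∈ U with j.val < i.val, Y j + if i ∈ U then Y i else 0 := by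
      simp only [Finset.sum_filter]
      rw [← Finset.sum_ite_eq U i Y, ← Finset.sum_add_distrib]
      refine Finset.sum_congr rfl fun j _ => ?_
      by_cases h1 : i = j
      · subst h1; simp
      · have h2 : (j : ℕ) ≠ i := fun e => h1 (Fin.ext e.symm)
        have h3 : (j : ℕ) < i + 1 ↔ (j : ℕ) < i := by omega
        simp [h1, h3]
    simp only [this, ha]; ring
  · have e1 : (U.filter fun i : Fin n => (i : ℕ) < n) = U := by simp
    simp only [e1, h0, hE]; simp
  · have := h1 (fun i => (i : ℕ) < k) (fun i j hij hj => lt_of_le_of_lt hij hj)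
    have := hE' k hk
    constructor <;> dsimp only <;> linarith

/-- The later end of each chord. -/
def heads {n : ℕ} (M : Fin n → Fin n) : Finset (Fin n) := Finset.univ.filter fun i => M i < i

/-! ### Existence of levels, by the parity and the position of the negative chords -/

section Core

variable {n : ℕ} {M : Fin n → Fin n}

theorem mem_heads (i : Fin n) : i ∈ heads M ↔ M i < i := by simp [heads]

theorem partner_mem_heads (hM : Function.Involutive M) (hM' : ∀ i, M i ≠ i) (i : Fin n) :
    M i ∈ heads M ↔ i ∉ heads M := by
  simp only [mem_heads, hM i, not_lt]
  exact ⟨le_of_lt, fun h => lt_of_le_of_ne h (hM' i).symm⟩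

/-- Reverse the sign of `Y` at the heads of the chords in `T`. -/
def flipHeads (M : Fin n → Fin n) (T : Finset (Fin n)) (Y : Fin n → ℤ) (i : Fin n) : ℤ :=
  if i ∈ T ∩ heads M then -Y i else Y i

/-- Exactly one end of each chord is a head, so reversing there turns opposite signs into equal
ones, as the negative chords in `T` require. -/
theorem flipHeads_partner (hM : Function.Involutive M) (hM' : ∀ i, M i ≠ i)
    {N T : Finset (Fin n)} (hTN : T ⊆ N) (hT : ∀ i ∈ T, M i ∈ T) {Y : Fin n → ℤ}
    (h1 : ∀ i ∈ N, i ∉ T → Y (M i) = Y i) (h2 : ∀ i, (i ∈ N → i ∈ T) → Y (M i) = -Y i) :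
    (∀ i ∈ N, flipHeads M T Y (M i) = flipHeads M T Y i) ∧
      ∀ i ∉ N, flipHeads M T Y (M i) = -flipHeads M T Y i := by
  have hMT : ∀ i, M i ∈ T ↔ i ∈ T := fun i => ⟨fun h => hM i ▸ hT _ h, hT i⟩
  constructor
  · intro i hi
    by_cases hiT : i ∈ T
    · have := h2 i fun _ => hiT
      by_cases hh : i ∈ heads M <;>
        simp [flipHeads, hMT, hiT, partner_mem_heads hM hM', hh, this]
    · simp [flipHeads, hMT, hiT, h1 i hi hiT]
  · intro i hi
    have hiT : i ∉ T := fun h => hi (hTN h)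
    simp [flipHeads, hMT, hiT, h2 i fun h => absurd h hi]

theorem abs_flipHeads {T : Finset (Fin n)} {Y : Fin n → ℤ} (hY : ∀ i, Y i = 1 ∨ Y i = -1)
    (i : Fin n) : |flipHeads M T Y i| = 1 := by
  unfold flipHeads
  split_ifs <;> rcases hY i with h | h <;> simp [h]

theorem hasLevels_of_even (hM : Function.Involutive M) (hM' : ∀ i, M i ≠ i)
    (N : Finset (Fin n)) (hN : ∀ i ∈ N, M i ∈ N) (hE : Even (N ∩ heads M).card) :
    HasLevels M N := by
  classical
  -- `exists_alternating` asks for a point `p` even when `D` is empty.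
  rcases n.eq_zero_or_pos with rfl | hn
  · exact ⟨fun _ => 0, fun _ => 0, fun i => i.elim0, rfl, by simp, fun i => i.elim0,
      fun i => i.elim0, fun i => i.elim0⟩
  have hU : Even (Finset.univ : Finset (Fin n)).card := by
    refine even_card_of_sum_eq_zero _ (fun i => if i ∈ heads M then 1 else -1)
      (fun i => by by_cases h : i ∈ heads M <;> simp [h]) ?_
    refine sum_eq_zero_of_involution _ _ hM hM' (by simp) fun i _ => ?_
    by_cases h : i ∈ heads M <;> simp [partner_mem_heads hM hM', h]
  obtain ⟨Q, hQ, hlev⟩ := exists_pairing_levels Finset.univ hU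
  obtain ⟨T, hTN, hT, hpar, -, hσ⟩ := exists_alternating hM hM' (fun i => (hQ i (by simp)).2.1)
    (fun i => (hQ i (by simp)).2.2) N ∅ (heads M) hN (by simp) ⟨0, hn⟩ (by simp) (by simp)
    (partner_mem_heads hM hM')
  set R := T ∩ heads M with hR
  have hRe : Even R.card := (Nat.even_add.1 hpar).1 hE
  -- Reversing a sign `2b - 1` adds `2 - 4b`, which is the change of `2b` when the bit `b` becomes
  -- `1 - b`.
  obtain ⟨Y, hY, hYQ, hY1, hY2, hYσ⟩ := hσ (fun i => 2 * (countBefore R i % 2) - 1)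
    (fun i => by omega)
  obtain ⟨c1, c2⟩ := flipHeads_partner hM hM' hTN hT hY1 hY2
  obtain ⟨l, hl, hl0, hl'⟩ := hlev Y hY (fun i _ => hYQ i) (fun k => 2 * (countBefore R k % 2))
    (flipHeads M T Y) (by
      simp only [countBefore_top, countBefore_zero]
      obtain ⟨r, hr⟩ := hRe
      omega) (fun k _ => by omega) (fun i => by
      simp only [Finset.mem_univ, if_true, countBefore_succ, flipHeads, ← hR]
      by_cases hi : i ∈ R
      · have := hYσ i (Finset.mem_inter.1 hi).2 (by simp [(Finset.mem_inter.1 hi).1])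
        simp only [hi, if_true, this]
        omega
      · simp [hi])
  exact ⟨flipHeads M T Y, l, hl, hl0, hl', c1, c2, fun i => Or.inl (abs_flipHeads hY i)⟩

theorem even_card_of_closed (hM : Function.Involutive M) (hM' : ∀ i, M i ≠ i)
    (S : Finset (Fin n)) (hS : ∀ i ∈ S, M i ∈ S) : Even S.card := by
  refine even_card_of_sum_eq_zero _ (fun i => if i ∈ heads M then 1 else -1)
    (fun i => by by_cases h : i ∈ heads M <;> simp [h]) ?_
  refine sum_eq_zero_of_involution _ _ hM hM' hS fun i _ => ?_
  by_cases h : i ∈ heads M <;> simp [partner_mem_heads hM hM', h]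

/-- A function with values in `{0, 1}` that changes exactly at the points of `S`. -/
def toggle (S : Finset (Fin n)) (p : Fin n) (k : ℕ) : ℤ := (countBefore S k + countBefore S p) % 2

theorem toggle_eq (S : Finset (Fin n)) (p : Fin n) (k : ℕ) : toggle S p k = 0 ∨ toggle S p k = 1 := by
  unfold toggle; omega

theorem toggle_self (S : Finset (Fin n)) (p : Fin n) : toggle S p p = 0 := by
  unfold toggle; omega

theorem toggle_succ (S : Finset (Fin n)) (p i : Fin n) :
    toggle S p (i + 1) = if i ∈ S then 1 - toggle S p i else toggle S p i := by
  unfold toggle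
  rw [countBefore_succ]
  split_ifs <;> omega

theorem toggle_top {S : Finset (Fin n)} (hS : Even S.card) (p : Fin n) :
    toggle S p n = toggle S p 0 := by
  unfold toggle
  rw [countBefore_top, countBefore_zero]
  obtain ⟨c, hc⟩ := hS
  omega

/-- The chord of `p` gets the value 2 and that of `q` a value `±1`. The correction is `h + 2b` with
bits `h` and `b`, where `h` changes only at the ends of `q`. Crossing means that exactly one end of
`q` lies between the ends of `p`, so the parity of the toggles of `b` there can be adjusted. -/
theorem hasLevels_of_crossing (hM : Function.Involutive M) (hM' : ∀ i, M i ≠ i)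
    (N : Finset (Fin n)) (hN : ∀ i ∈ N, M i ∈ N) (hodd : ¬ Even (N ∩ heads M).card)
    (p q : Fin n) (hp : p ∈ N) (hq : q ∈ N) (hpq : p < q) (hqp : q < M p) (hpq' : M p < M q) :
    HasLevels M N := by
  classical
  set U : Finset (Fin n) := Finset.univ \ {p, M p, q, M q} with hU
  have hUiff : ∀ i, i ∈ U ↔ i ≠ p ∧ i ≠ M p ∧ i ≠ q ∧ i ≠ M q := fun i => by simp [hU]
  have hMiff : ∀ i j, M i = j ↔ i = M j := fun i j =>
    ⟨fun h => by rw [← h, hM], fun h => by rw [h, hM]⟩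
  have hUM : ∀ i, M i ∈ U ↔ i ∈ U := fun i => by
    simp only [hUiff, ne_eq, hMiff, hM p, hM q]; tauto
  obtain ⟨Q, hQ, hlev⟩ := exists_pairing_levels U
    (even_card_of_closed hM hM' U fun i hi => (hUM i).2 hi)
  -- Each of the two special chords becomes an orbit by itself and is therefore defective.
  set Q' : Fin n → Fin n := fun i => if i ∈ U then Q i else M i with hQ'
  obtain ⟨T, hTN, hT, hpar, -, hσ⟩ := exists_alternating (Q := Q') hM hM' (fun i => by
      by_cases hi : i ∈ U
      · simp [hQ', hi, hQ i hi]
      · simp [hQ', hi, hUM, hM i]) (fun i => by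
      by_cases hi : i ∈ U
      · simp [hQ', hi, (hQ i hi).2.2]
      · simp [hQ', hi, hM']) N ∅ (heads M) hN (by simp) p (by simp) (by simp)
    (partner_mem_heads hM hM')
  have hmem : ∀ i, i ∈ N → i ∉ U → i ∈ T := by
    intro i hi hiU
    by_contra hiT
    obtain ⟨Y, hY, hYQ, hY1, -⟩ := hσ (fun _ => 1) (fun _ => Or.inl rfl)
    have h1 := hYQ i
    simp only [hQ', hiU, if_false] at h1
    rw [hY1 i hi hiT] at h1
    rcases hY i with h | h <;> omega
  have hMpN := hN p hp
  have hMqN := hN q hq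
  -- Defective chords are odd in number; leaving out that of `q` makes the number of toggles even.
  set R := (T ∩ heads M).erase (M q) with hR
  have hMqR : M q ∈ T ∩ heads M := by
    simp only [Finset.mem_inter, mem_heads, hM q]
    exact ⟨hmem _ hMqN (by simp [hUiff]), by omega⟩
  have hMpR : M p ∈ R := by
    simp only [hR, Finset.mem_erase, Finset.mem_inter, mem_heads, hM p]
    exact ⟨hpq'.ne, hmem _ hMpN (by simp [hUiff]), by omega⟩
  have hRe : Even R.card := by
    have h1 := Finset.card_erase_add_one hMqR
    have h2 : ¬ Even (T ∩ heads M).card := fun h => hodd ((Nat.even_add.1 hpar).2 h)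
    rw [← h1, Nat.even_add_one, not_not] at h2
    exact h2
  have hpR : p ∉ R := by
    simp only [hR, Finset.mem_erase, Finset.mem_inter, mem_heads]
    rintro ⟨-, -, h⟩; omega
  have hqR : q ∉ R := by
    simp only [hR, Finset.mem_erase, Finset.mem_inter, mem_heads]
    rintro ⟨-, -, h⟩; omega
  -- `b` must step from 0 to 1 at both ends of `p`. The end `z` of `q` at which `b` also toggles is
  -- chosen to make `b` vanish at `M p`.
  obtain ⟨z, hz, hzS⟩ : ∃ z, (z = q ∨ z = M q) ∧ toggle (insert z (insert p R)) p (M p) = 0 := by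
    have key : ∀ z, (z = q ∨ z = M q) → toggle (insert z (insert p R)) p (M p) =
        (countBefore R (M p) + countBefore R p + 1 + if (z : ℕ) < M p then 1 else 0) % 2 := by
      intro z hz
      have hzp : z ∉ insert p R := by
        rcases hz with rfl | rfl
        · simp [hqR, hpq.ne']
        · simp only [Finset.mem_insert, not_or, hR, Finset.mem_erase]
          exact ⟨by omega, by simp⟩
      have h1 : ¬ (z : ℕ) < p := by rcases hz with rfl | rfl <;> omega
      have h2 : (p : ℕ) < M p := by omega
      simp only [toggle, countBefore_insert hzp, countBefore_insert hpR, h1, h2, if_true,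
        if_false, lt_irrefl]
      omega
    rcases Int.emod_two_eq_zero_or_one (countBefore R (M p) + countBefore R p) with h | h
    · refine ⟨q, Or.inl rfl, ?_⟩
      rw [key q (Or.inl rfl), if_pos (by omega)]; omega
    · refine ⟨M q, Or.inr rfl, ?_⟩
      rw [key (M q) (Or.inr rfl), if_neg (by omega)]; omega
  set S := insert z (insert p R) with hS
  have hzp : z ∉ insert p R := by
    rcases hz with rfl | rfl
    · simp [hqR, hpq.ne']
    · simp only [Finset.mem_insert, not_or, hR, Finset.mem_erase]
      exact ⟨by omega, by simp⟩
  have hSe : Even S.card := by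
    rw [hS, Finset.card_insert_of_notMem hzp, Finset.card_insert_of_notMem hpR, Nat.even_add_one,
      Nat.even_add_one, not_not]
    exact hRe
  set b := toggle S p with hb
  have hb01 : ∀ k, b k = 0 ∨ b k = 1 := toggle_eq S p
  have hbp : b p = 0 := toggle_self S p
  have hbs : ∀ i : Fin n, b (i + 1) = if i ∈ S then 1 - b i else b i := toggle_succ S p
  have hbn : b n = b 0 := toggle_top hSe p
  obtain ⟨Y, hY, hYQ, hY1, hY2, hYσ⟩ := hσ (fun i => 2 * b i - 1)
    (fun i => by rcases hb01 i with h | h <;> simp [h])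
  obtain ⟨c1, c2⟩ := flipHeads_partner hM hM' hTN hT hY1 hY2
  -- At `z` the toggle of `b` contributes `2y` and the bit `h` contributes `-y`; at the other end of
  -- `q` only `h` moves, by `y`.
  set y := 1 - 2 * b z with hy
  obtain ⟨h0, h1, hh0, hh1, hu⟩ : ∃ h0 h1 : ℤ, (h0 = 0 ∨ h0 = 1) ∧ (h1 = 0 ∨ h1 = 1) ∧
      h1 - h0 = if z = q then -y else y := by
    have hy' : y = 1 ∨ y = -1 := by rcases hb01 z with h | h <;> simp [hy, h]
    split_ifs <;> rcases hy' with h | h <;> rw [h]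
    · exact ⟨1, 0, by norm_num⟩
    · exact ⟨0, 1, by norm_num⟩
    · exact ⟨0, 1, by norm_num⟩
    · exact ⟨1, 0, by norm_num⟩
  set h : ℕ → ℤ := fun k => if (q : ℕ) < k ∧ k ≤ M q then h1 else h0 with hh
  have hq1 : h q = h0 := by simp [hh]
  have hq2 : h (q + 1) = h1 := if_pos (by omega)
  have hq3 : h (M q) = h1 := if_pos (by omega)
  have hq4 : h (M q + 1) = h0 := if_neg (by omega)
  have hother : ∀ i : Fin n, i ≠ q → i ≠ M q → h (i + 1) = h i := by
    intro i hi hi'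
    have e1 : (i : ℕ) ≠ q := fun e => hi (Fin.ext e)
    have e2 : (i : ℕ) ≠ M q := fun e => hi' (Fin.ext e)
    have : ((q : ℕ) < i + 1 ∧ (i : ℕ) + 1 ≤ M q) ↔ ((q : ℕ) < i ∧ (i : ℕ) ≤ M q) := by omega
    simp only [hh, this]
  set a : Fin n → ℤ := fun i => if i = p ∨ i = M p then 2 else if i = q ∨ i = M q then y
    else flipHeads M T Y i with ha
  have hyv : |y| = 1 := by rcases hb01 z with h | h <;> simp [hy, h]
  obtain ⟨l, hl, hl0, hl'⟩ := hlev Y hY (fun i hi => by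
      have := hYQ i
      simpa [hQ', hi] using this) (fun k => h k + 2 * b k) a (by
      have e1 : h n = h0 := if_neg (by have := (M q).2; omega)
      have e2 : h 0 = h0 := if_neg (by omega)
      simp only [e1, e2, hbn]) (fun k _ => by
      have : h k = h1 ∨ h k = h0 := by
        simp only [hh]; split_ifs <;> simp
      rcases hb01 k with h | h <;> rw [h] <;> omega) (fun i => by
      simp only [hbs]
      by_cases hip : i = p
      · have hiS : i ∈ S := by simp [hS, hip]
        rw [hother i (by rw [hip]; exact hpq.ne) (by rw [hip]; omega)]
        simp only [hUiff, ha, hip, hbp]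
        simp [hS]
      by_cases hip' : i = M p
      · have hiS : i ∈ S := by simp [hS, hip', hMpR]
        rw [hother i (by rw [hip']; exact hqp.ne') (by rw [hip']; exact hpq'.ne), if_pos hiS]
        have hiU : i ∉ U := by simp [hUiff, hip']
        rw [if_neg hiU, hip', hzS]
        simp [ha]
      by_cases hiq : i = q ∨ i = M q
      · have hiU : i ∉ U := by rw [hUiff]; tauto
        have hai : a i = y := by simp [ha, hip, hip', hiq]
        rw [hai, if_neg hiU]
        have hiS : i ∈ S ↔ i = z := by
          have : i ∉ R := by
            rcases hiq with rfl | rfl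
            · exact hqR
            · simp [hR]
          simp [hS, hip, this]
        by_cases hiz : i = z
        · rw [if_pos (hiS.2 hiz)]
          rcases hiq with h | h
          · rw [if_pos (by rw [← hiz, h])] at hu
            rw [h, hq1, hq2]
            have : b q = b z := by rw [← hiz, h]
            rw [this]
            linarith
          · rw [if_neg (by rw [← hiz, h]; omega)] at hu
            rw [h, hq3, hq4]
            have : b (M q) = b z := by rw [← hiz, h]
            rw [this]
            linarith
        · rw [if_neg fun h => hiz (hiS.1 h)]
          rcases hiq with h | h
          · rw [if_neg (by rw [← h]; exact Ne.symm hiz)] at hu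
            rw [h, hq1, hq2]
            linarith
          · have hzq : z = q := hz.resolve_right (by rw [← h]; exact Ne.symm hiz)
            rw [if_pos hzq] at hu
            rw [h, hq3, hq4]
            linarith
      · have hiU : i ∈ U := by rw [hUiff]; tauto
        have hai : a i = flipHeads M T Y i := by simp [ha, hip, hip', hiq]
        rw [hai, if_pos hiU, hother i (by tauto) (by tauto)]
        have hiS : i ∈ S ↔ i ∈ T ∩ heads M := by
          have h1 : i ≠ z := by rintro rfl; exact hiq hz
          have h2 : i ≠ M q := by tauto
          simp [hS, hip, h1, hR, h2]
        by_cases hiT : i ∈ T ∩ heads M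
        · have := hYσ i (Finset.mem_inter.1 hiT).2 (by simp [(Finset.mem_inter.1 hiT).1])
          rw [if_pos (hiS.2 hiT)]
          simp only [flipHeads, hiT, if_true, this]
          ring
        · rw [if_neg fun h => hiT (hiS.1 h)]
          simp only [flipHeads, hiT, if_false]; ring)
  have e1 : ∀ i, (M i = p ∨ M i = M p) ↔ (i = p ∨ i = M p) := fun i => by
    rw [hMiff, hM.injective.eq_iff, or_comm]
  have e2 : ∀ i, (M i = q ∨ M i = M q) ↔ (i = q ∨ i = M q) := fun i => by
    rw [hMiff, hM.injective.eq_iff, or_comm]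
  refine ⟨a, l, hl, hl0, hl', fun i hi => ?_, fun i hi => ?_, fun i => ?_⟩
  · simp only [ha, e1, e2, c1 i hi]
  · have n1 : ¬ (i = p ∨ i = M p) := by rintro (rfl | rfl) <;> contradiction
    have n2 : ¬ (i = q ∨ i = M q) := by rintro (rfl | rfl) <;> contradiction
    simp only [ha, e1, e2, n1, n2, if_false, c2 i hi]
  · simp only [ha]
    split_ifs
    · right; rfl
    · left; exact hyv
    · left; exact abs_flipHeads hY i

theorem toggle_bot_eq_zero {S : Finset (Fin n)} {p q : Fin n} (hpq : ∀ i ∈ S, p ≤ i ∧ q ≤ i) :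
    toggle S p q = 0 := by
  have h : ∀ r : Fin n, (∀ i ∈ S, r ≤ i) → countBefore S r = 0 := by
    intro r hr
    simp only [countBefore, Nat.cast_eq_zero, Finset.card_eq_zero, Finset.filter_eq_empty_iff,
      not_lt]
    exact hr
  rw [toggle, h p fun i hi => (hpq i hi).1, h q fun i hi => (hpq i hi).2]
  rfl

/-- Pairing `p` with `q` puts both chords into one orbit, and `D`, the chord of `p`, absorbs its
defect. The value `-2` goes to the chord of `q` if that of `p` is defective, and to the chord of `p`
otherwise. As `p` and `q` lie outside `U`, their steps come from the correction `h + 2b`. -/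
theorem hasLevels_of_consecutive (hM : Function.Involutive M) (hM' : ∀ i, M i ≠ i)
    (N : Finset (Fin n)) (hN : ∀ i ∈ N, M i ∈ N) (hodd : ¬ Even (N ∩ heads M).card)
    (p q : Fin n) (hp0 : (p : ℕ) = 0) (hp : p ∈ N) (hlast : ∀ j ∈ N, j ≤ M p)
    (hq : q ∈ N) (hqp : q ≠ p) (hqp' : q ≠ M p) (hfirst : ∀ j ∈ N, j ≠ p → q ≤ j) :
    HasLevels M N := by
  classical
  have hMpN := hN p hp
  have hMqN := hN q hq
  have hpM : (p : ℕ) < M p := by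
    have : (M p : ℕ) ≠ p := fun e => hM' p (Fin.ext e)
    omega
  have hqlt : q < M p := lt_of_le_of_ne (hlast q hq) hqp'
  have hMqp : M q ≠ p := fun e => hqp' (by rw [← e, hM])
  have hMqMp : M q ≠ M p := fun e => hqp (hM.injective e)
  have hqM : q < M q := lt_of_le_of_ne (hfirst _ hMqN hMqp) (hM' q).symm
  set U : Finset (Fin n) := (Finset.univ.erase p).erase q with hU
  have hUiff : ∀ i, i ∈ U ↔ i ≠ p ∧ i ≠ q := fun i => by simp [hU, and_comm]
  have hUe : Even U.card := by
    have h1 : Even (Finset.univ : Finset (Fin n)).card :=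
      even_card_of_closed hM hM' _ (by simp)
    rw [← Finset.card_erase_add_one (Finset.mem_univ p),
      ← Finset.card_erase_add_one (s := Finset.univ.erase p) (a := q) (by simp [hqp]),
      Nat.even_add_one, Nat.even_add_one, not_not] at h1
    exact h1
  obtain ⟨Q, hQ, hlev⟩ := exists_pairing_levels U hUe
  set Q' : Fin n → Fin n := fun i => if i = p then q else if i = q then p else Q i with hQ'
  have hQU : ∀ i ∈ U, Q' i = Q i := fun i hi => by
    simp [hQ', ((hUiff i).1 hi).1, ((hUiff i).1 hi).2]
  have hQp : Q' p = q := by simp [hQ']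
  have hQq : Q' q = p := by simp [hQ', hqp]
  have hcases : ∀ i, i = p ∨ i = q ∨ i ∈ U := fun i => by rw [hUiff]; tauto
  obtain ⟨T, hTN, hT, hpar, hDT, hσ⟩ := exists_alternating (Q := Q') hM hM' (fun i => by
      rcases hcases i with hi | hi | hi
      · rw [hi, hQp, hQq]
      · rw [hi, hQq, hQp]
      · rw [hQU i hi, hQU _ (hQ i hi).1, (hQ i hi).2.1]) (fun i => by
      rcases hcases i with hi | hi | hi
      · rw [hi, hQp]; exact hqp
      · rw [hi, hQq]; exact hqp.symm
      · rw [hQU i hi]; exact (hQ i hi).2.2) N {p, M p} (heads M) hN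
    (by intro i; simp only [Finset.mem_insert, Finset.mem_singleton]
        rintro (h | h) <;> rwa [h]) p (by simp)
    (by intro i; simp only [Finset.mem_insert, Finset.mem_singleton]
        rintro (h | h) <;> simp [h, hM p])
    (partner_mem_heads hM hM')
  have hqT : q ∉ T := fun h => hDT q h (by simp [hqp, hqp']) p (by simp)
    (by have := linked_right M Q' q; rwa [hQq] at this)
  have hMqT : M q ∉ T := fun h => hqT (hM q ▸ hT _ h)
  set R := T ∩ heads M with hR
  have hRo : ¬ Even R.card := fun h => hodd ((Nat.even_add.1 hpar).2 h)
  have hpR : p ∉ R := by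
    simp only [hR, Finset.mem_inter, mem_heads, not_and, not_lt]
    intro _; exact Fin.le_def.2 hpM.le
  have hqR : q ∉ R := fun h => hqT (Finset.mem_inter.1 h).1
  have hMqR : M q ∉ R := fun h => hMqT (Finset.mem_inter.1 h).1
  have hRN : ∀ i ∈ R, i ∈ N := fun i hi => hTN (Finset.mem_inter.1 hi).1
  have hMp_heads : M p ∈ heads M := by rw [mem_heads, hM]; exact Fin.lt_def.2 hpM
  have hMiff : ∀ i j, M i = j ↔ i = M j := fun i j =>
    ⟨fun h => by rw [← h, hM], fun h => by rw [h, hM]⟩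
  have hswap : ∀ r i, (M i = r ∨ M i = M r) ↔ (i = r ∨ i = M r) := fun r i => by
    rw [hMiff, hM.injective.eq_iff, or_comm]
  by_cases hpT : p ∈ T
  · have hMpR : M p ∈ R := Finset.mem_inter.2 ⟨hT p hpT, hMp_heads⟩
    set S := insert q R with hS
    have hSe : Even S.card := by
      rw [hS, Finset.card_insert_of_notMem hqR, Nat.even_add_one]; exact hRo
    have hSlow : ∀ i ∈ S, p ≤ i ∧ q ≤ i := by
      intro i hi
      refine ⟨Fin.le_def.2 (by omega), ?_⟩
      rcases Finset.mem_insert.1 hi with rfl | h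
      · exact le_rfl
      · exact hfirst i (hRN i h) fun e => hpR (e ▸ h)
    set b : ℕ → ℤ := fun k => 1 - toggle S p k with hb
    have hb01 : ∀ k, b k = 0 ∨ b k = 1 := fun k => by
      simp only [hb]; rcases toggle_eq S p k with h | h <;> omega
    have hbs : ∀ i : Fin n, b (i + 1) = if i ∈ S then 1 - b i else b i := fun i => by
      simp only [hb, toggle_succ]; split_ifs <;> ring
    have hbn : b n = b 0 := by simp only [hb, toggle_top hSe]
    have hb0 : b 0 = 1 := by
      simp only [hb]; rw [← hp0, toggle_self]; rfl
    have hbq : b q = 1 := by simp only [hb, toggle_bot_eq_zero hSlow]; rfl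
    -- `M p` is the last toggle, and `b` must return to its initial value 1, so it is 0 before that
    -- toggle.
    have hbMp : b (M p) = 0 := by
      have hconst : ∀ k, (M p : ℕ) + 1 ≤ k → k ≤ n → b k = b (M p + 1) := by
        intro k hk
        induction k, hk using Nat.le_induction with
        | base => intro _; rfl
        | succ k hk ih =>
          intro hkn
          have := hbs ⟨k, hkn⟩
          rw [if_neg] at this
          · rw [this, ← ih (by omega)]
          · intro h
            have hkN : (⟨k, hkn⟩ : Fin n) ∈ N := by
              rcases Finset.mem_insert.1 h with h | h
              · rw [h]; exact hq
              · exact hRN _ h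
            have := Fin.le_def.1 (hlast _ hkN)
            simp only at this
            omega
      have h1 := hconst n (M p).2 le_rfl
      have h2 := hbs (M p)
      rw [if_pos (Finset.mem_insert_of_mem hMpR), ← h1, hbn, hb0] at h2
      omega
    obtain ⟨Y, hY, hYQ, hY1, hY2, hYσ⟩ := hσ (fun i => 2 * b i - 1)
      (fun i => by rcases hb01 i with h | h <;> simp [h])
    obtain ⟨c1, c2⟩ := flipHeads_partner hM hM' hTN hT hY1 hY2
    have hYMp : Y (M p) = -1 := by
      rw [hYσ _ hMp_heads (by simp), hbMp]; rfl
    have hYp : Y p = 1 := by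
      have := hY2 p fun _ => hpT
      rw [hYMp] at this; omega
    have hYq : Y q = -1 := by
      have := hYQ p
      rw [hQp, hYp] at this; exact this
    have hYMq : Y (M q) = -1 := by rw [hY1 q hq hqT, hYq]
    -- The rise of `h` is the step `+1` at `p`. Its fall joins `Y (M q) = -1` to give `-2` at `M q`,
    -- matching the step `-2` of `2b` at `q`.
    set h : ℕ → ℤ := fun k => if (p : ℕ) < k ∧ k ≤ M q then 1 else 0 with hh
    have hp1 : h p = 0 := by simp [hh]
    have hp2 : h (p + 1) = 1 := if_pos (by omega)
    have hq1 : h (M q) = 1 := if_pos (by omega)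
    have hq2 : h (M q + 1) = 0 := if_neg (by omega)
    have hother : ∀ i : Fin n, i ≠ p → i ≠ M q → h (i + 1) = h i := by
      intro i hi hi'
      have e1 : (i : ℕ) ≠ p := fun e => hi (Fin.ext e)
      have e2 : (i : ℕ) ≠ M q := fun e => hi' (Fin.ext e)
      have : ((p : ℕ) < i + 1 ∧ (i : ℕ) + 1 ≤ M q) ↔ ((p : ℕ) < i ∧ (i : ℕ) ≤ M q) := by omega
      simp only [hh, this]
    set a : Fin n → ℤ := fun i => if i = q ∨ i = M q then -2 else flipHeads M T Y i with ha
    obtain ⟨l, hl, hl0, hl'⟩ := hlev Y hY (fun i hi => by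
        rw [← hQU i hi]; exact hYQ i) (fun k => h k + 2 * b k) a (by
        have e1 : h n = 0 := if_neg (by have := (M q).2; omega)
        have e2 : h 0 = 0 := if_neg (by omega)
        simp only [e1, e2, hbn]) (fun k _ => by
        have : h k = 1 ∨ h k = 0 := by
          simp only [hh]; split_ifs <;> simp
        rcases hb01 k with h | h <;> rw [h] <;> omega) (fun i => by
        simp only [hbs]
        by_cases hip : i = p
        · have hiS : i ∉ S := by simp [hS, hip, hpR, hqp.symm]
          have hiU : i ∉ U := by simp [hUiff, hip]
          have hai : a i = 1 := by
            simp [ha, hip, hqp.symm, hMqp.symm, flipHeads, ← hR, hpR, hYp]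
          rw [if_neg hiS, if_neg hiU, hai, hip, hp1, hp2]; ring
        by_cases hiq : i = q
        · have hiS : i ∈ S := by simp [hS, hiq]
          have hiU : i ∉ U := by simp [hUiff, hiq]
          have hai : a i = -2 := by simp [ha, hiq]
          rw [if_pos hiS, if_neg hiU, hai, hother i hip (by rw [hiq]; exact hqM.ne), hiq, hbq]
          ring
        have hiU : i ∈ U := by simp [hUiff, hip, hiq]
        rw [if_pos hiU]
        by_cases hiq' : i = M q
        · have hiS : i ∉ S := by simp [hS, hiq', hMqR, hM']
          have hai : a i = -2 := by simp [ha, hiq']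
          rw [if_neg hiS, hai, hiq', hq1, hq2, hYMq]; ring
        have hiS : i ∈ S ↔ i ∈ R := by simp [hS, hiq]
        have hai : a i = flipHeads M T Y i := by simp [ha, hiq, hiq']
        rw [hai, hother i hip hiq']
        by_cases hiR : i ∈ R
        · have := hYσ i (Finset.mem_inter.1 hiR).2 (by simp [(Finset.mem_inter.1 hiR).1])
          rw [if_pos (hiS.2 hiR)]
          simp only [flipHeads, ← hR, hiR, if_true, this]
          ring
        · rw [if_neg fun h => hiR (hiS.1 h)]
          simp only [flipHeads, ← hR, hiR, if_false]; ring)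
    refine ⟨a, l, hl, hl0, hl', fun i hi => ?_, fun i hi => ?_, fun i => ?_⟩
    · simp only [ha, hswap, c1 i hi]
    · have n1 : ¬ (i = q ∨ i = M q) := by rintro (rfl | rfl) <;> contradiction
      simp only [ha, hswap, n1, if_false, c2 i hi]
    · simp only [ha]
      split_ifs
      · right; rfl
      · left; exact abs_flipHeads hY i
  · have hMpT : M p ∉ T := fun h => hpT (hM p ▸ hT _ h)
    have hMpR : M p ∉ R := fun h => hMpT (Finset.mem_inter.1 h).1
    set S := insert p R with hS
    have hSe : Even S.card := by
      rw [hS, Finset.card_insert_of_notMem hpR, Nat.even_add_one]; exact hRo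
    set b : ℕ → ℤ := fun k => 1 - toggle S p k with hb
    have hb01 : ∀ k, b k = 0 ∨ b k = 1 := fun k => by
      simp only [hb]; rcases toggle_eq S p k with h | h <;> omega
    have hbs : ∀ i : Fin n, b (i + 1) = if i ∈ S then 1 - b i else b i := fun i => by
      simp only [hb, toggle_succ]; split_ifs <;> ring
    have hbn : b n = b 0 := by simp only [hb, toggle_top hSe]
    have hbp : b p = 1 := by simp only [hb, toggle_self]; rfl
    -- The chord of `p` is not defective here, so the sign at `M p` is not tied to `b` and can be
    -- fixed through `D`.
    obtain ⟨Y, hY, hYQ, hY1, hY2, hYσ⟩ := hσ (fun i => if i = M p then -1 else 2 * b i - 1)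
      (fun i => by split_ifs; · simp
                   · rcases hb01 i with h | h <;> simp [h])
    obtain ⟨c1, c2⟩ := flipHeads_partner hM hM' hTN hT hY1 hY2
    have hYMp : Y (M p) = -1 := by
      rw [hYσ _ hMp_heads (by simp), if_pos rfl]
    have hYp : Y p = -1 := by
      rw [← hYMp, hY1 p hp hpT]
    have hYq : Y q = 1 := by
      have := hYQ p
      rw [hQp, hYp] at this; exact this
    -- The rise of `h` supplies the step `Y q = 1` at `q`. Its fall and `Y (M p) = -1` make `-2` at
    -- `M p`, while `2b` drops by 2 at `p`.
    set h : ℕ → ℤ := fun k => if (q : ℕ) < k ∧ k ≤ M p then 1 else 0 with hh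
    have hq1 : h q = 0 := by simp [hh]
    have hq2 : h (q + 1) = 1 := if_pos (by omega)
    have hp1 : h (M p) = 1 := if_pos (by omega)
    have hp2 : h (M p + 1) = 0 := if_neg (by omega)
    have hother : ∀ i : Fin n, i ≠ q → i ≠ M p → h (i + 1) = h i := by
      intro i hi hi'
      have e1 : (i : ℕ) ≠ q := fun e => hi (Fin.ext e)
      have e2 : (i : ℕ) ≠ M p := fun e => hi' (Fin.ext e)
      have : ((q : ℕ) < i + 1 ∧ (i : ℕ) + 1 ≤ M p) ↔ ((q : ℕ) < i ∧ (i : ℕ) ≤ M p) := by omega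
      simp only [hh, this]
    set a : Fin n → ℤ := fun i => if i = p ∨ i = M p then -2 else flipHeads M T Y i with ha
    obtain ⟨l, hl, hl0, hl'⟩ := hlev Y hY (fun i hi => by
        rw [← hQU i hi]; exact hYQ i) (fun k => h k + 2 * b k) a (by
        have e1 : h n = 0 := if_neg (by have := (M p).2; omega)
        have e2 : h 0 = 0 := if_neg (by omega)
        simp only [e1, e2, hbn]) (fun k _ => by
        have : h k = 1 ∨ h k = 0 := by
          simp only [hh]; split_ifs <;> simp
        rcases hb01 k with h | h <;> rw [h] <;> omega) (fun i => by
        simp only [hbs]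
        by_cases hip : i = p
        · have hiS : i ∈ S := by simp [hS, hip]
          have hiU : i ∉ U := by simp [hUiff, hip]
          have hai : a i = -2 := by simp [ha, hip]
          rw [if_pos hiS, if_neg hiU, hai, hother i (by rw [hip]; exact hqp.symm)
            (by rw [hip]; exact (hM' p).symm), hip, hbp]; ring
        by_cases hiq : i = q
        · have hiS : i ∉ S := by simp [hS, hiq, hqR, hqp]
          have hiU : i ∉ U := by simp [hUiff, hiq]
          have hai : a i = 1 := by simp [ha, hiq, hqp, hqp', flipHeads, ← hR, hqR, hYq]
          rw [if_neg hiS, if_neg hiU, hai, hiq, hq1, hq2]; ring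
        have hiU : i ∈ U := by simp [hUiff, hip, hiq]
        rw [if_pos hiU]
        by_cases hip' : i = M p
        · have hiS : i ∉ S := by simp [hS, hip', hMpR, hM']
          have hai : a i = -2 := by simp [ha, hip']
          rw [if_neg hiS, hai, hip', hp1, hp2, hYMp]; ring
        have hiS : i ∈ S ↔ i ∈ R := by simp [hS, hip]
        have hai : a i = flipHeads M T Y i := by simp [ha, hip, hip']
        rw [hai, hother i hiq hip']
        by_cases hiR : i ∈ R
        · have := hYσ i (Finset.mem_inter.1 hiR).2 (by simp [(Finset.mem_inter.1 hiR).1])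
          rw [if_neg hip'] at this
          rw [if_pos (hiS.2 hiR)]
          simp only [flipHeads, ← hR, hiR, if_true, this]
          ring
        · rw [if_neg fun h => hiR (hiS.1 h)]
          simp only [flipHeads, ← hR, hiR, if_false]; ring)
    refine ⟨a, l, hl, hl0, hl', fun i hi => ?_, fun i hi => ?_, fun i => ?_⟩
    · simp only [ha, hswap, c1 i hi]
    · have n1 : ¬ (i = p ∨ i = M p) := by rintro (rfl | rfl) <;> contradiction
      simp only [ha, hswap, n1, if_false, c2 i hi]
    · simp only [ha]
      split_ifs
      · right; rfl
      · left; exact abs_flipHeads hY i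

theorem card_eq_two_mul_heads (hM : Function.Involutive M) (hM' : ∀ i, M i ≠ i)
    (N : Finset (Fin n)) (hN : ∀ i ∈ N, M i ∈ N) : N.card = 2 * (N ∩ heads M).card := by
  classical
  have h : (N \ heads M).card = (N ∩ heads M).card := by
    refine Finset.card_nbij' M M (fun i hi => ?_) (fun i hi => ?_) (fun i _ => hM i)
      (fun i _ => hM i)
    · simp only [Finset.coe_sdiff, Set.mem_sdiff, Finset.mem_coe, Finset.coe_inter,
        Set.mem_inter_iff] at hi ⊢
      exact ⟨hN i hi.1, (partner_mem_heads hM hM' i).2 hi.2⟩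
    · simp only [Finset.coe_sdiff, Set.mem_sdiff, Finset.mem_coe, Finset.coe_inter,
        Set.mem_inter_iff] at hi ⊢
      exact ⟨hN i hi.1, fun h => (partner_mem_heads hM hM' i).1 h hi.2⟩
  have := Finset.card_sdiff_add_card_inter N (heads M)
  omega

theorem HasLevels.of_rotate (N N' : Finset (Fin n)) (t : ℕ) (ht : t ≤ n) (e : Fin n ≃ Fin n)
    (he : ∀ i, (e i : ℕ) = if (i : ℕ) + t < n then i + t else i + t - n)
    (hN' : ∀ i, i ∈ N' ↔ e i ∈ N) (h : HasLevels (fun i => e.symm (M (e i))) N') :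
    HasLevels M N := by
  obtain ⟨a, l, hl, hl0, hl', h1, h2, h3⟩ := h
  have hs : ∀ i, (e.symm i : ℕ) = if (i : ℕ) < t then i + n - t else i - t := by
    intro i
    have := he (e.symm i)
    rw [Equiv.apply_symm_apply] at this
    have := (e.symm i).2
    have := i.2
    split_ifs at * <;> omega
  refine ⟨fun i => a (e.symm i), fun k => if k < t then l (k + n - t) else l (k - t),
    fun i => ?_, ?_, fun k hk => ?_, fun i hi => ?_, fun i hi => ?_, fun i => h3 _⟩
  · have e1 := hl (e.symm i)
    have e2 := hs i
    have := i.2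
    rcases lt_trichotomy ((i : ℕ) + 1) t with h | h | h
    · simp only [h, (by omega : (i : ℕ) < t), if_true] at e2 ⊢
      rw [e2] at e1
      rw [← e1]; congr 1; omega
    · simp only [h, (by omega : (i : ℕ) < t), if_true, lt_irrefl, if_false, Nat.sub_self] at e2 ⊢
      rw [e2] at e1
      rw [← e1, ← hl0]; congr 1; omega
    · rw [if_neg (by omega)] at e2
      rw [e2] at e1
      dsimp only
      rw [if_neg (by omega), if_neg (by omega), ← e1]; congr 1; omega
  · dsimp only
    rw [if_neg (by omega)]
    by_cases h : 0 < t
    · rw [if_pos h]; congr 1; omega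
    · have : t = 0 := by omega
      subst this; simpa using hl0
  · dsimp only
    split_ifs
    · exact hl' _ (by omega)
    · exact hl' _ (by omega)
  · have := h1 (e.symm i) ((hN' _).2 (by simpa using hi))
    simpa using this
  · have := h2 (e.symm i) fun h => hi (by simpa using (hN' _).1 h)
    simpa using this

theorem hasLevels (hM : Function.Involutive M) (hM' : ∀ i, M i ≠ i)
    (N : Finset (Fin n)) (hN : ∀ i ∈ N, M i ∈ N) (h : ∀ i ∈ N, ∃ j ∈ N, j ≠ i ∧ j ≠ M i) :
    HasLevels M N := by
  classical
  by_cases hodd : Even (N ∩ heads M).card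
  · exact hasLevels_of_even hM hM' N hN hodd
  by_cases hcross : ∃ p ∈ N, ∃ q ∈ N, p < q ∧ q < M p ∧ M p < M q
  · obtain ⟨p, hp, q, hq, h1, h2, h3⟩ := hcross
    exact hasLevels_of_crossing hM hM' N hN hodd p q hp hq h1 h2 h3
  push Not at hcross
  have hne : (N ∩ heads M).Nonempty := by
    rw [← Finset.card_pos]
    by_contra h0
    exact hodd ⟨0, by omega⟩
  -- A shortest negative chord has no negative end strictly inside: the chord of such an end would
  -- cross it or be shorter. Rotating `t` to position 0 then makes `M t` the last negative end.
  obtain ⟨t, ht, hmin⟩ := Finset.exists_min_image (N ∩ heads M) (fun i => (i : ℕ) - M i) hne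
  rw [Finset.mem_inter, mem_heads] at ht
  have hMt := hN t ht.1
  have hnone : ∀ j ∈ N, j ≤ M t ∨ t ≤ j := by
    intro j hj
    by_contra hc
    push Not at hc
    have hjM := hM' j
    have hMj := hN j hj
    rcases lt_or_gt_of_ne hjM with h1 | h1
    · have h2 := hmin j (Finset.mem_inter.2 ⟨hj, by rwa [mem_heads]⟩)
      have h3 : M j ≠ M t := fun e => hc.2.ne (hM.injective e)
      have h4 : M j < M t := by
        refine lt_of_le_of_ne ?_ h3
        by_contra h5
        push Not at h5
        have := ht.2
        omega
      have := hcross (M j) hMj (M t) hMt h4 (by rw [hM]; exact hc.1)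
      rw [hM, hM] at this
      omega
    · have h3 : M j ≠ t := fun e => hc.1.ne' (by rw [← e, hM])
      have h2 : t < M j := by
        refine lt_of_le_of_ne ?_ h3.symm
        by_contra h5
        push Not at h5
        have := hmin (M j) (Finset.mem_inter.2 ⟨hMj, by rwa [mem_heads, hM]⟩)
        rw [hM] at this
        omega
      have := hcross (M t) hMt j hj hc.1 (by rw [hM]; exact hc.2)
      rw [hM] at this
      omega
  have hnz : NeZero n := ⟨by have := t.2; omega⟩
  let e : Fin n ≃ Fin n := Equiv.addRight t
  have he : ∀ i, (e i : ℕ) = if (i : ℕ) + t < n then (i : ℕ) + t else i + t - n := by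
    intro i
    change ((i + t : Fin n) : ℕ) = _
    rw [Fin.val_add_eq_ite]
    split_ifs <;> omega
  have hs : ∀ i, (e.symm i : ℕ) = if i < t then (i : ℕ) + n - t else i - t := by
    intro i
    have := he (e.symm i)
    rw [Equiv.apply_symm_apply] at this
    have := (e.symm i).2
    have := i.2
    split_ifs at * <;> omega
  set N' : Finset (Fin n) := N.map e.symm.toEmbedding with hN'
  have hN'iff : ∀ i, i ∈ N' ↔ e i ∈ N := fun i => by
    simp only [hN', Finset.mem_map_equiv, Equiv.symm_symm]
  set M₁ : Fin n → Fin n := fun i => e.symm (M (e i)) with hM₁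
  refine HasLevels.of_rotate N N' t t.2.le e he hN'iff ?_
  have hMinv : Function.Involutive M₁ := fun i => by simp [hM₁, hM (e i)]
  have hMne : ∀ i, M₁ i ≠ i := fun i hi => hM' (e i) (by
    rw [hM₁] at hi
    exact (Equiv.symm_apply_eq e).1 hi)
  have hMN : ∀ i ∈ N', M₁ i ∈ N' := fun i hi => by
    rw [hN'iff] at hi ⊢
    simpa [hM₁] using hN _ hi
  -- Rotation may change which end of a chord is its head, but not the number of chords.
  have hodd' : ¬ Even (N' ∩ heads M₁).card := by
    have h1 := card_eq_two_mul_heads hM hM' N hN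
    have h2 := card_eq_two_mul_heads hMinv hMne N' hMN
    have h3 : N'.card = N.card := Finset.card_map _
    have : (N' ∩ heads M₁).card = (N ∩ heads M).card := by omega
    rwa [this]
  set p := e.symm t with hp
  have hep : e p = t := by simp [hp]
  have hp0 : (p : ℕ) = 0 := by rw [hp, hs]; simp
  have hpN : p ∈ N' := by rw [hN'iff, hep]; exact ht.1
  have hMp : M₁ p = e.symm (M t) := by simp [hM₁, hep]
  have hlast : ∀ j ∈ N', j ≤ M₁ p := by
    intro j hj
    have h1 := hnone _ ((hN'iff j).1 hj)
    have h2 := hs (M t)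
    rw [if_pos ht.2] at h2
    have h3 := he j
    rw [hMp, Fin.le_def, h2]
    have h4 := ht.2
    have h5 := j.2
    rw [Fin.le_def, Fin.le_def] at h1
    rw [Fin.lt_def] at h4
    split_ifs at h3 <;> omega
  obtain ⟨j, hj, hjt, hjt'⟩ := h t ht.1
  have hj' : e.symm j ∈ N'.erase p := by
    simp only [Finset.mem_erase, hN'iff, Equiv.apply_symm_apply, hj, and_true, hp]
    exact fun h => hjt (e.symm.injective h)
  set q := (N'.erase p).min' ⟨_, hj'⟩ with hq
  have hqm : q ∈ N'.erase p := Finset.min'_mem _ _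
  rw [Finset.mem_erase] at hqm
  have hfirst : ∀ i ∈ N', i ≠ p → q ≤ i := fun i hi hip =>
    Finset.min'_le _ _ (Finset.mem_erase.2 ⟨hip, hi⟩)
  have hqMp : q ≠ M₁ p := by
    intro hqe
    have h1 := hfirst _ (Finset.mem_of_mem_erase hj') (Finset.ne_of_mem_erase hj')
    have h2 := hlast _ (Finset.mem_of_mem_erase hj')
    have h3 : e.symm j = M₁ p := le_antisymm h2 (hqe ▸ h1)
    rw [hMp] at h3
    exact hjt' (e.symm.injective h3)
  exact hasLevels_of_consecutive hMinv hMne N' hMN hodd' p q hp0 hpN hlast hqm.2 hqm.1 hqMp hfirst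

end Core

/-! ### From points in a row to points grouped at places -/

/-- The levels for points that are distributed over `k` cyclically ordered places. -/
theorem exists_levels {ι : Type*} [Fintype ι] [DecidableEq ι] {M : ι → ι}
    (hM : Function.Involutive M) (hM' : ∀ i, M i ≠ i) (N : Set ι) (hN : ∀ i ∈ N, M i ∈ N)
    (h : ∀ i ∈ N, ∃ j ∈ N, j ≠ i ∧ j ≠ M i) (k : ℕ) (place : ι → ℕ) (hk : ∀ i, place i < k) :
    ∃ (a : ι → ℤ) (l : ℕ → ℤ),
      (∀ j, l (j + 1) = l j + ∑ i with place i = j, a i) ∧ l k = l 0 ∧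
      (∀ j, -1 ≤ l j ∧ l j ≤ 4) ∧ (∀ i ∈ N, a (M i) = a i) ∧ (∀ i ∉ N, a (M i) = -a i) ∧
      ∀ i, |a i| = 1 ∨ |a i| = 2 := by
  classical
  let e₀ := Fintype.equivFin ι
  let n := Fintype.card ι
  let s := Tuple.sort (fun i : Fin n => place (e₀.symm i))
  have hs : Monotone fun i : Fin n => place (e₀.symm (s i)) :=
    Tuple.monotone_sort (fun i : Fin n => place (e₀.symm i))
  let e : ι ≃ Fin n := e₀.trans s.symm
  have he : Monotone fun i : Fin n => place (e.symm i) := hs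
  have hlev : HasLevels (fun i => e (M (e.symm i))) (Finset.univ.filter fun i => e.symm i ∈ N) := by
    refine hasLevels (fun i => by simp [hM _]) (fun i hi => hM' (e.symm i) ?_) _ (fun i hi => ?_)
      fun i hi => ?_
    · exact e.eq_symm_apply.2 hi
    · simpa using hN _ (by simpa using hi)
    · obtain ⟨j, hj, h1, h2⟩ := h (e.symm i) (by simpa using hi)
      refine ⟨e j, by simpa using hj, fun h => h1 ?_, fun h => h2 (e.injective h)⟩
      rw [← h, Equiv.symm_apply_apply]
  obtain ⟨a, l, hl, hl0, hl', h1, h2, h3⟩ := hlev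
  -- With the points sorted by place, the levels are sampled at the position where place `j` begins.
  let c : ℕ → ℕ := fun j => (Finset.univ.filter fun i : Fin n => place (e.symm i) < j).card
  have hc : ∀ j, c j ≤ n := fun j => (Finset.card_filter_le _ _).trans (by simp [n])
  have hcmem : ∀ (i : Fin n) j, place (e.symm i) < j ↔ (i : ℕ) < c j := by
    intro i j
    constructor
    · intro hi
      have : Finset.Iic i ⊆ Finset.univ.filter fun i : Fin n => place (e.symm i) < j := by
        intro x hx
        simp only [Finset.mem_filter, Finset.mem_univ, true_and]
        exact lt_of_le_of_lt (he (Finset.mem_Iic.1 hx)) hi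
      have := Finset.card_le_card this
      rw [Fin.card_Iic] at this
      exact this
    · intro hi
      by_contra hij
      have : (Finset.univ.filter fun i : Fin n => place (e.symm i) < j) ⊆ Finset.Iio i := by
        intro x hx
        simp only [Finset.mem_filter, Finset.mem_univ, true_and] at hx
        rw [Finset.mem_Iio]
        by_contra hxi
        exact hij (lt_of_le_of_lt (he (not_lt.1 hxi)) hx)
      have := Finset.card_le_card this
      rw [Fin.card_Iio] at this
      exact absurd hi (not_lt.2 this)
  have hsum : ∀ m ≤ n, l m = l 0 + ∑ i : Fin n with i.val < m, a i := by
    intro m hm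
    induction m with
    | zero => simp
    | succ m ih =>
      have h4 := hl ⟨m, hm⟩
      simp only at h4
      rw [h4, ih (by omega), add_assoc]
      congr 1
      have : (Finset.univ.filter fun i : Fin n => (i : ℕ) < m + 1) =
          insert ⟨m, hm⟩ (Finset.univ.filter fun i : Fin n => (i : ℕ) < m) := by
        ext i
        simp only [Finset.mem_filter, Finset.mem_univ, true_and, Finset.mem_insert, Fin.ext_iff]
        omega
      rw [this, Finset.sum_insert (by simp), add_comm]
  have hlc : ∀ j, l (c j) = l 0 + ∑ i with place i < j, a (e i) := by
    intro j
    rw [hsum _ (hc j)]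
    congr 1
    refine (Finset.sum_equiv e (fun i => ?_) fun i _ => rfl).symm
    simp [← hcmem]
  refine ⟨fun i => a (e i), fun j => l (c j), fun j => ?_, ?_, fun j => hl' _ (hc j),
    fun i hi => ?_, fun i hi => ?_, fun i => h3 _⟩
  · simp only [hlc]
    rw [add_assoc]
    congr 1
    simp only [Finset.sum_filter]
    rw [← Finset.sum_add_distrib]
    refine Finset.sum_congr rfl fun i _ => ?_
    rcases lt_trichotomy (place i) j with h | h | h
    · simp [h, h.ne, (by omega : place i < j + 1)]
    · simp [h]
    · rw [if_neg (by omega), if_neg (by omega), if_neg (by omega), add_zero]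
  · have e1 : c k = n := by simp [c, hk, n]
    have e2 : c 0 = 0 := by simp [c]
    simp only [e1, e2, hl0]
  · have := h1 (e i) (by simpa using hi)
    simpa using this
  · have := h2 (e i) (by simpa using hi)
    simpa using this

/-! ### Cyclic enumeration of a circuit, and switching -/

variable {α β : Type*}

/-- A cyclic enumeration `v 0, e 0, v 1, e 1, …, v k = v 0, e k = e 0` of a circuit. -/
structure IsCyclicEnum (C : Graph α β) (k : ℕ) (v : ℕ → α) (e : ℕ → β) : Prop where
  pos : 0 < k
  vertex_last : v k = v 0
  edge_last : e k = e 0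
  isLink : ∀ j < k, C.IsLink (e j) (v j) (v (j + 1))
  edge_ne : ∀ j < k, e j ≠ e (j + 1)
  injOn : Set.InjOn v (Set.Iio k)
  edge_injOn : Set.InjOn e (Set.Iio k)
  inc_iff : ∀ j < k, ∀ f, C.Inc f (v (j + 1)) ↔ f = e j ∨ f = e (j + 1)
  exists_eq : ∀ x ∈ C.vertexSet, ∃ j < k, x = v (j + 1)

theorem exists_inc_ne {C : Graph α β} [C.Loopless] (hC : IsCircuit C) {x : α} {e : β}
    (he : C.Inc e x) : ∃ e', C.Inc e' x ∧ e' ≠ e ∧ ∀ f, C.Inc f x → f = e ∨ f = e' := by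
  have h := hC.regular x he.vertex_mem
  have h0 : C.loopSet x = ∅ := by
    ext f; simp
  rw [degree, h0, Set.ncard_empty, add_zero, Set.ncard_eq_two] at h
  obtain ⟨p, q, hpq, h⟩ := h
  have hi : ∀ f, C.Inc f x ↔ f = p ∨ f = q := fun f => by
    rw [← Graph.mem_incidenceSet, h]; rfl
  rcases (hi e).1 he with rfl | rfl
  · exact ⟨q, (hi q).2 (Or.inr rfl), hpq.symm, fun f hf => (hi f).1 hf⟩
  · exact ⟨p, (hi p).2 (Or.inl rfl), hpq, fun f hf => ((hi f).1 hf).symm⟩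

theorem exists_nonbacktracking {C : Graph α β} [C.Loopless] (hC : IsCircuit C) :
    ∃ (v : ℕ → α) (e : ℕ → β), ∀ j, C.IsLink (e j) (v j) (v (j + 1)) ∧ e j ≠ e (j + 1) := by
  have hstep : ∀ d : {d : α × β // C.Inc d.2 d.1}, ∃ d' : {d : α × β // C.Inc d.2 d.1},
      C.IsLink d.1.2 d.1.1 d'.1.1 ∧ d.1.2 ≠ d'.1.2 := by
    rintro ⟨⟨x, e⟩, y, hy⟩
    obtain ⟨e', he', hne, -⟩ := exists_inc_ne hC hy.inc_right
    exact ⟨⟨(y, e'), he'⟩, hy, hne.symm⟩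
  choose next hnext using hstep
  obtain ⟨x, hx⟩ := hC.connected.nonempty
  have h := hC.regular x hx
  have h0 : C.loopSet x = ∅ := by
    ext f; simp
  rw [degree, h0, Set.ncard_empty, add_zero, Set.ncard_eq_two] at h
  obtain ⟨p, q, -, h⟩ := h
  have hp : C.Inc p x := by
    rw [← Graph.mem_incidenceSet, h]; exact Or.inl rfl
  let d : ℕ → {d : α × β // C.Inc d.2 d.1} := fun n => next^[n] ⟨(x, p), hp⟩
  have hd : ∀ n, d (n + 1) = next (d n) := fun n => Function.iterate_succ_apply' _ _ _
  refine ⟨fun n => (d n).1.1, fun n => (d n).1.2, fun j => ?_⟩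
  simp only [hd]
  exact hnext _

/-- Follow a walk that never reuses the edge just traversed until a vertex first repeats. By
2-regularity the repetition is at the start, and the closed walk exhausts the circuit by
connectedness. -/
theorem exists_isCyclicEnum {C : Graph α β} [C.Loopless] (hC : IsCircuit C)
    (hV : C.vertexSet.Finite) : ∃ k v e, IsCyclicEnum C k v e := by
  classical
  obtain ⟨v, e, hve⟩ := exists_nonbacktracking hC
  have hrep : ∃ r, ∃ i < r, v r = v i := by
    have hmem : ∀ n, v n ∈ C.vertexSet := fun n => (hve n).1.left_mem
    obtain ⟨i, -, j, -, hne, hij⟩ := Set.infinite_univ.exists_ne_map_eq_of_mapsTo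
      (f := v) (fun n _ => hmem n) hV
    rcases lt_or_gt_of_ne hne with h | h
    · exact ⟨j, i, h, hij.symm⟩
    · exact ⟨i, j, h, hij⟩
  obtain ⟨i, hir, hri⟩ := Nat.find_spec hrep
  set r := Nat.find hrep with hr
  have hinj : Set.InjOn v (Set.Iio r) := by
    intro a ha b hb hab
    by_contra hne
    rcases lt_or_gt_of_ne hne with h | h
    · exact Nat.find_min hrep hb ⟨a, h, hab.symm⟩
    · exact Nat.find_min hrep ha ⟨b, h, hab⟩
  have htwo : ∀ j f, C.Inc f (v (j + 1)) → f = e j ∨ f = e (j + 1) := by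
    intro j f hf
    obtain ⟨e', -, -, h⟩ := exists_inc_ne hC (hve j).1.inc_right
    have h1 := h _ (hve (j + 1)).1.inc_left
    rcases h f hf with h2 | h2
    · exact Or.inl h2
    · rcases h1 with h1 | h1
      · exact absurd h1.symm (hve j).2
      · exact Or.inr (h2.trans h1.symm)
  have hr2 : 2 ≤ r := by
    by_contra hlt
    have h1 : r = 1 := by omega
    have h2 : i = 0 := by omega
    rw [h1, h2] at hri
    exact (hve 0).1.ne hri.symm
  obtain ⟨m, hm⟩ : ∃ m, r = m + 1 := ⟨r - 1, by omega⟩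
  have hlink := (hve m).1
  rw [← hm, hri] at hlink
  have hnot : e m ≠ e i := by
    intro h
    rw [h] at hlink
    have h1 := hlink.symm.right_unique (hve i).1
    have h2 : i + 1 < r := by
      by_contra h2
      have : i = m := by omega
      subst this
      exact hlink.ne rfl
    have h3 : m = i + 1 := hinj (show m < r by omega) h2 h1
    exact (hve i).2 (by rw [← h3, h])
  -- A return to a later vertex would arrive there by a third edge.
  have hi0 : i = 0 := by
    by_contra hi0
    obtain ⟨i', rfl⟩ : ∃ i', i = i' + 1 := ⟨i - 1, by omega⟩
    rcases htwo i' (e m) hlink.inc_right with h | h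
    · rw [h] at hlink
      have h1 := hlink.symm.right_unique (hve i').1.symm
      have := hinj (show m < r by omega) (show i' < r by omega) h1
      omega
    · exact hnot h
  subst hi0
  have hinc0 : ∀ f, C.Inc f (v 0) → f = e m ∨ f = e 0 := by
    intro f hf
    obtain ⟨e', -, -, h⟩ := exists_inc_ne hC hlink.inc_right
    have h1 := h _ (hve 0).1.inc_left
    rcases h f hf with h2 | h2
    · exact Or.inl h2
    · rcases h1 with h1 | h1
      · exact absurd h1.symm hnot
      · exact Or.inr (h2.trans h1.symm)
  set e' : ℕ → β := fun j => if j < r then e j else e 0 with he'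
  have he1 : ∀ j < r, e' j = e j := fun j hj => if_pos hj
  have he2 : e' r = e 0 := if_neg (lt_irrefl _)
  have hne' : ∀ j < r, e' j ≠ e' (j + 1) := by
    intro j hj
    rw [he1 j hj]
    by_cases h : j + 1 < r
    · rw [he1 _ h]; exact (hve j).2
    · have : j = m := by omega
      subst this
      rw [← hm, he2]; exact hnot
  have hinciff : ∀ j < r, ∀ f, C.Inc f (v (j + 1)) ↔ f = e' j ∨ f = e' (j + 1) := by
    intro j hj f
    rw [he1 j hj]
    by_cases h : j + 1 < r
    · rw [he1 _ h]
      refine ⟨htwo j f, ?_⟩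
      rintro (rfl | rfl)
      · exact (hve j).1.inc_right
      · exact (hve (j + 1)).1.inc_left
    · have : j = m := by omega
      subst this
      rw [← hm, he2, hri]
      refine ⟨hinc0 f, ?_⟩
      rintro (rfl | rfl)
      · exact hlink.inc_right
      · exact (hve 0).1.inc_left
  have hlink' : ∀ j < r, C.IsLink (e' j) (v j) (v (j + 1)) := fun j hj => by
    rw [he1 j hj]; exact (hve j).1
  have hlt : ∀ a b, a < b → b < r → e' a ≠ e' b := by
    intro a b hab hb h
    have h1 := hlink' a (by omega)
    rw [h] at h1
    rcases h1.eq_and_eq_or_eq_and_eq (hlink' b hb) with ⟨h2, -⟩ | ⟨-, h2⟩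
    · exact hab.ne (hinj (show a < r by omega) hb h2)
    · have := hinj (show a + 1 < r by omega) hb h2
      subst this
      exact hne' a (by omega) h
  have hclosed : ∀ x y, C.Adj x y → (∃ j < r, x = v (j + 1)) → ∃ j < r, y = v (j + 1) := by
    rintro x y ⟨f, hf⟩ ⟨j, hj, rfl⟩
    rcases (hinciff j hj f).1 hf.inc_left with rfl | rfl
    · have h1 := hf.right_unique (hlink' j hj).symm
      rcases Nat.eq_zero_or_pos j with rfl | hj0
      · exact ⟨m, by omega, by rw [h1, ← hm, hri]⟩
      · exact ⟨j - 1, by omega, by rw [h1, Nat.sub_add_cancel hj0]⟩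
    · by_cases h : j + 1 < r
      · exact ⟨j + 1, h, hf.right_unique (hlink' _ h)⟩
      · have h1 : j + 1 = r := by omega
        rw [h1, he2, hri, ← he1 0 (by omega)] at hf
        exact ⟨0, by omega, hf.right_unique (hlink' 0 (by omega))⟩
  refine ⟨r, v, e', by omega, hri, by rw [he2, he1 0 (by omega)], hlink', hne', hinj, ?_,
    hinciff, fun x hx => ?_⟩
  · intro a ha b hb hab
    by_contra hne
    rcases lt_or_gt_of_ne hne with h | h
    · exact hlt a b h hb hab
    · exact hlt b a h ha hab.symm
  · have h := hC.connected.joined (v 1) (hve 1).1.left_mem x hx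
    induction h with
    | refl => exact ⟨0, by omega, rfl⟩
    | tail _ h2 ih => exact hclosed _ _ h2 (ih h2.left_mem)

theorem IsCyclicEnum.exists_edge_eq {C : Graph α β} {k : ℕ} {v : ℕ → α} {e : ℕ → β}
    (h : IsCyclicEnum C k v e) {f : β} (hf : f ∈ C.edgeSet) : ∃ j < k, f = e j := by
  obtain ⟨x, y, hxy⟩ := C.exists_isLink_of_mem_edgeSet hf
  obtain ⟨j, hj, rfl⟩ := h.exists_eq x hxy.left_mem
  rcases (h.inc_iff j hj f).1 hxy.inc_left with rfl | rfl
  · exact ⟨j, hj, rfl⟩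
  · rcases Nat.lt_or_ge (j + 1) k with h1 | h1
    · exact ⟨_, h1, rfl⟩
    · refine ⟨0, h.pos, ?_⟩
      rw [← h.edge_last]; congr 1; omega

/-- A balanced circuit can be switched to have positive edges only. -/
theorem IsCyclicEnum.exists_switching {C : Graph α β} {k : ℕ} {v : ℕ → α} {e : ℕ → β}
    (h : IsCyclicEnum C k v e) {σ : β → ℤˣ} (hσ : IsBalanced σ C) :
    ∃ s : α → ℤˣ, ∀ j < k, σ (e j) = s (v j) * s (v (j + 1)) := by
  classical
  let S : ℕ → ℤˣ := fun j => ∏ i ∈ Finset.range j, σ (e i)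
  have hS : S k = 1 := by
    rw [← hσ, subgraphSign]
    have hEC : C.edgeSet = ↑((Finset.range k).image e) := by
      ext f
      simp only [Finset.coe_image, Finset.coe_range, Set.mem_image, Set.mem_Iio]
      constructor
      · intro hf
        obtain ⟨j, hj, rfl⟩ := h.exists_edge_eq hf
        exact ⟨j, hj, rfl⟩
      · rintro ⟨j, hj, rfl⟩
        exact (h.isLink j hj).edge_mem
    rw [hEC, finprod_mem_coe_finset, Finset.prod_image]
    simpa using h.edge_injOn
  let s : α → ℤˣ := fun x => S (Function.invFunOn v (Set.Iio k) x)
  have hs : ∀ j < k, s (v j) = S j := fun j hj => by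
    simp only [s]
    rw [h.injOn.leftInvOn_invFunOn (show j ∈ Set.Iio k from hj)]
  have hs' : ∀ j ≤ k, s (v j) = S j := by
    intro j hj
    rcases hj.lt_or_eq with h1 | rfl
    · exact hs j h1
    · rw [h.vertex_last, hs 0 h.pos, hS]; simp [S]
  refine ⟨s, fun j hj => ?_⟩
  rw [hs' j hj.le, hs' (j + 1) hj]
  simp only [S, Finset.prod_range_succ]
  rw [← mul_assoc, Int.units_mul_self, one_mul]

/-! ### Half edges, and the exclusion of a single negative edge -/

/-- The half edges of a loopless graph, as pairs of an edge and one of its ends. -/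
abbrev HalfEdge (G : Graph α β) := {p : α × β // G.Inc p.2 p.1}

/-- The other half of the edge. -/
noncomputable def HalfEdge.swap {G : Graph α β} (p : HalfEdge G) : HalfEdge G :=
  ⟨(p.2.other, p.1.2), p.2.inc_other⟩

namespace HalfEdge

variable {G : Graph α β}

theorem isLink_swap (p : HalfEdge G) : G.IsLink p.1.2 p.1.1 p.swap.1.1 := p.2.isLink_other

theorem swap_edge (p : HalfEdge G) : p.swap.1.2 = p.1.2 := rfl

theorem swap_eq {x y : α} {f : β} (h : G.IsLink f x y) :
    swap (⟨(x, f), h.inc_left⟩ : HalfEdge G) = ⟨(y, f), h.inc_right⟩ := by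
  have h1 := isLink_swap (⟨(x, f), h.inc_left⟩ : HalfEdge G)
  exact Subtype.ext (Prod.ext (h1.right_unique h) rfl)

theorem swap_involutive : Function.Involutive (swap (G := G)) := by
  rintro ⟨⟨x, f⟩, y, h⟩
  rw [swap_eq h, swap_eq h.symm]

theorem swap_ne [G.Loopless] (p : HalfEdge G) : p.swap ≠ p := fun h => by
  have := p.isLink_swap.ne
  rw [h] at this
  exact this rfl

theorem eq_or_eq_swap {p q : HalfEdge G} (h : p.1.2 = q.1.2) : p = q ∨ p = q.swap := by
  obtain ⟨⟨x, f⟩, hp⟩ := p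
  obtain ⟨⟨y, g⟩, z, hq⟩ := q
  dsimp only at h hp hq
  subst h
  rw [swap_eq hq]
  rcases hp.eq_or_eq_of_isLink hq with rfl | rfl
  · exact Or.inl rfl
  · exact Or.inr rfl

theorem finite (hV : G.vertexSet.Finite) (hE : G.edgeSet.Finite) : Finite (HalfEdge G) := by
  refine Set.Finite.subset (hV.prod hE) ?_
  rintro ⟨x, f⟩ (h : G.Inc f x)
  exact ⟨h.vertex_mem, h.edge_mem⟩

end HalfEdge

theorem finsum_incidenceSet (G : Graph α β) [Fintype (HalfEdge G)] [DecidableEq α]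
    (g : β → ℤ) (x : α) :
    ∑ᶠ f ∈ G.incidenceSet x, g f = ∑ p : HalfEdge G with p.1.1 = x, g p.1.2 := by
  classical
  have hinj : Set.InjOn (fun p : HalfEdge G => p.1.2)
      ↑(Finset.univ.filter fun p : HalfEdge G => p.1.1 = x) := by
    intro p hp q hq h
    simp only [Finset.coe_filter, Finset.mem_univ, true_and, Set.mem_ofPred_eq] at hp hq
    exact Subtype.ext (Prod.ext (hp.trans hq.symm) h)
  have h : G.incidenceSet x =
      ↑((Finset.univ.filter fun p : HalfEdge G => p.1.1 = x).image fun p => p.1.2) := by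
    ext f
    simp only [Graph.mem_incidenceSet, Finset.coe_image, Set.mem_image, Finset.coe_filter,
      Finset.mem_univ, true_and, Set.mem_ofPred_eq]
    constructor
    · intro h
      exact ⟨⟨(x, f), h⟩, rfl, rfl⟩
    · rintro ⟨p, rfl, rfl⟩
      exact p.2
  rw [h, finsum_mem_coe_finset, Finset.sum_image hinj]

/-- In a flow-admissible signed graph no switching makes exactly one edge negative. -/
theorem exists_ne_negative_edge {G : Graph α β} [G.Loopless] (hV : G.vertexSet.Finite)
    (hE : G.edgeSet.Finite) {σ : β → ℤˣ} (hadm : FlowAdmissible G σ) (s : α → ℤˣ) {f : β}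
    {x y : α} (hf : G.IsLink f x y) (hσ : σ f ≠ s x * s y) :
    ∃ f' x' y', G.IsLink f' x' y' ∧ f' ≠ f ∧ σ f' ≠ s x' * s y' := by
  classical
  obtain ⟨k, -, τ, φ, hflow, hnz⟩ := hadm
  by_contra! hcon
  have := HalfEdge.finite hV hE
  have := Fintype.ofFinite (HalfEdge G)
  -- This is the flow after switching by `s`. Its total is zero, positive edges cancel, and a single
  -- negative edge would leave a nonzero multiple of its own value.
  let g : HalfEdge G → ℤ := fun p => s p.1.1 * (τ p.1.1 p.1.2 * φ p.1.2)
  have hsum : ∑ p, g p = 0 := by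
    have hmaps : ∀ p ∈ (Finset.univ : Finset (HalfEdge G)), p.1.1 ∈ hV.toFinset := fun p _ => by
      simpa using p.2.vertex_mem
    rw [← Finset.sum_fiberwise_of_maps_to hmaps]
    refine Finset.sum_eq_zero fun z hz => ?_
    have h1 := hflow.boundary_eq_zero z (by simpa using hz)
    rw [boundary, finsum_incidenceSet] at h1
    calc _ = ∑ p : HalfEdge G with p.1.1 = z, (s z : ℤ) * (τ z p.1.2 * φ p.1.2) :=
          Finset.sum_congr rfl fun p hp => by
            rw [← (Finset.mem_filter.1 hp).2]
      _ = 0 := by rw [← Finset.mul_sum, h1, mul_zero]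
  have hori : ∀ p : HalfEdge G, τ p.1.1 p.1.2 * τ p.swap.1.1 p.1.2 = -σ p.1.2 :=
    fun p => hflow.orientation _ _ _ p.isLink_swap
  have hval : ∀ p : HalfEdge G, g p.swap =
      s p.1.1 * s p.swap.1.1 * (τ p.1.1 p.1.2 * τ p.swap.1.1 p.1.2) * g p := by
    intro p
    have h1 : ((s p.1.1 : ℤˣ) : ℤ) * s p.1.1 = 1 := by
      rw [← Units.val_mul, Int.units_mul_self, Units.val_one]
    have h2 : ((τ p.1.1 p.1.2 : ℤˣ) : ℤ) * τ p.1.1 p.1.2 = 1 := by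
      rw [← Units.val_mul, Int.units_mul_self, Units.val_one]
    simp only [g, HalfEdge.swap_edge]
    linear_combination (-(s p.swap.1.1 : ℤ) * τ p.swap.1.1 p.1.2 * φ p.1.2) *
      (h1 * τ p.1.1 p.1.2 * τ p.1.1 p.1.2 + h2)
  have hneg : ∀ p : HalfEdge G, σ p.1.2 = s p.1.1 * s p.swap.1.1 → g p + g p.swap = 0 := by
    intro p hp
    have h1 := hori p
    have h2 : s p.1.1 * s p.swap.1.1 * (τ p.1.1 p.1.2 * τ p.swap.1.1 p.1.2) = -1 := by
      rw [h1, hp, mul_neg, Int.units_mul_self]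
    have h3 : (s p.1.1 : ℤ) * s p.swap.1.1 * (τ p.1.1 p.1.2 * τ p.swap.1.1 p.1.2) = -1 := by
      simpa using congrArg Units.val h2
    rw [hval, h3]; ring
  have hpos : ∀ p : HalfEdge G, σ p.1.2 ≠ s p.1.1 * s p.swap.1.1 → g p.swap = g p := by
    intro p hp
    rw [Int.units_ne_iff_eq_neg] at hp
    have h1 := hori p
    have h2 : s p.1.1 * s p.swap.1.1 * (τ p.1.1 p.1.2 * τ p.swap.1.1 p.1.2) = 1 := by
      rw [h1, hp, neg_neg, Int.units_mul_self]
    have h3 : (s p.1.1 : ℤ) * s p.swap.1.1 * (τ p.1.1 p.1.2 * τ p.swap.1.1 p.1.2) = 1 := by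
      simpa using congrArg Units.val h2
    rw [hval, h3, one_mul]
  let p₀ : HalfEdge G := ⟨(x, f), hf.inc_left⟩
  have hp₀ : g p₀.swap = g p₀ := hpos p₀ (by rw [HalfEdge.swap_eq hf]; exact hσ)
  have hsum' : ∑ p, (g p + g p.swap) = 0 := by
    rw [Finset.sum_add_distrib, hsum, zero_add, ← hsum]
    exact Equiv.sum_comp HalfEdge.swap_involutive.toPerm g
  rw [← Finset.sum_subset (Finset.subset_univ {p₀, p₀.swap}),
    Finset.sum_pair (HalfEdge.swap_ne p₀).symm, HalfEdge.swap_involutive, hp₀] at hsum'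
  · have h1 : (s x : ℤ) * (τ x f * φ f) = 0 := by
      change g p₀ = 0
      omega
    simp only [mul_eq_zero, Units.ne_zero, false_or] at h1
    exact hnz f hf.edge_mem h1
  · intro p _ hp
    refine hneg p (hcon _ _ _ p.isLink_swap fun h => hp ?_)
    rcases HalfEdge.eq_or_eq_swap (p := p) (q := p₀) h with h | h <;> simp [h]

theorem IsCyclicEnum.vertex_succ_inj {C : Graph α β} {k : ℕ} {v : ℕ → α} {e : ℕ → β}
    (h : IsCyclicEnum C k v e) {i j : ℕ} (hi : i < k) (hj : j < k)
    (hij : v (i + 1) = v (j + 1)) : i = j := by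
  have key : ∀ a b, a < k → b < k → a < b → v (a + 1) = v (b + 1) → False := by
    intro a b ha hb hab hv
    rcases Nat.lt_or_ge (b + 1) k with h1 | h1
    · have := h.injOn (show a + 1 < k by omega) h1 hv
      omega
    · have h2 : b + 1 = k := by omega
      rw [h2, h.vertex_last] at hv
      have := h.injOn (show a + 1 < k by omega) h.pos hv
      omega
  by_contra hne
  rcases lt_or_gt_of_ne hne with h1 | h1
  · exact key i j hi hj h1 hij
  · exact key j i hj hi h1 hij.symm

/-! ### The flow obtained from the levels -/

/-- The flow that is read off from the levels along a Hamiltonian circuit. -/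
theorem admitsNZF_of_levels {G C D : Graph α β} [G.Loopless] (hC : Graph.IsSpanningSubgraph C G)
    (hD : D = G.deleteEdges C.edgeSet)
    (hE : G.edgeSet.Finite) {k : ℕ} {v : ℕ → α} {e : ℕ → β} (h : IsCyclicEnum C k v e)
    {σ : β → ℤˣ} (s : α → ℤˣ) (hs : ∀ j < k, σ (e j) = s (v j) * s (v (j + 1)))
    [Fintype (HalfEdge D)] (place : HalfEdge D → ℕ) (hk : ∀ p, place p < k)
    (hplace : ∀ p, p.1.1 = v (place p + 1))
    (a : HalfEdge D → ℤ) (l : ℕ → ℤ)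
    (hl : ∀ j, l (j + 1) = l j + ∑ p with place p = j, a p) (hl0 : l k = l 0)
    (hl' : ∀ j, -1 ≤ l j ∧ l j ≤ 4)
    (ha : ∀ p, σ p.1.2 ≠ s p.1.1 * s p.swap.1.1 → a p.swap = a p)
    (ha' : ∀ p, σ p.1.2 = s p.1.1 * s p.swap.1.1 → a p.swap = -a p)
    (habs : ∀ p, |a p| = 1 ∨ |a p| = 2) : AdmitsNZF G σ 6 := by
  classical
  have hle : C ≤ G := hC.le
  have : C.Loopless := Graph.Loopless.anti hle
  have hDG : ∀ f x, D.Inc f x ↔ G.Inc f x ∧ f ∉ C.edgeSet := fun f x => by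
    rw [hD, Graph.deleteEdges_inc]
  have hsw : ∀ p : HalfEdge D, |a p.swap| = |a p| := fun p => by
    by_cases hp : σ p.1.2 = s p.1.1 * s p.swap.1.1
    · rw [ha' p hp, abs_neg]
    · rw [ha p hp]
  have hCe : ∀ j < k, e j ∈ C.edgeSet := fun j hj => (h.isLink j hj).edge_mem
  obtain ⟨F, hF, hF'⟩ : ∃ F : β → ℤ, (∀ j < k, F (e j) = 2 * l j - 3) ∧
      ∀ p : HalfEdge D, F p.1.2 = 2 * |a p| := by
    refine ⟨fun f => if hf : ∃ p : HalfEdge D, p.1.2 = f then 2 * |a hf.choose|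
      else 2 * l (Function.invFunOn e (Set.Iio k) f) - 3, fun j hj => ?_, fun p => ?_⟩
    · dsimp only
      rw [dif_neg, h.edge_injOn.leftInvOn_invFunOn (show j ∈ Set.Iio k from hj)]
      rintro ⟨p, hp⟩
      exact ((hDG _ _).1 p.2).2 (hp ▸ hCe j hj)
    · have hf : ∃ q : HalfEdge D, q.1.2 = p.1.2 := ⟨p, rfl⟩
      dsimp only
      rw [dif_pos hf]
      rcases HalfEdge.eq_or_eq_swap hf.choose_spec with h1 | h1
      · rw [h1]
      · rw [h1, hsw]
  have hFk : ∀ j ≤ k, F (e j) = 2 * l j - 3 := by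
    intro j hj
    rcases hj.lt_or_eq with h1 | rfl
    · exact hF j h1
    · rw [h.edge_last, hl0, hF 0 h.pos]
  -- Up to switching, circuit edges point forward. On chords the orientation absorbs the sign of
  -- `a`, since `F` only carries `2 * |a|`, which is the same at both ends.
  obtain ⟨τ, hτ₁, hτ₂, hτ⟩ : ∃ τ : α → β → ℤˣ, (∀ j < k, τ (v j) (e j) = s (v j)) ∧
      (∀ j < k, τ (v (j + 1)) (e j) = -s (v (j + 1))) ∧
      ∀ p : HalfEdge D, τ p.1.1 p.1.2 = s p.1.1 * if 0 < a p then -1 else 1 := by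
    have hnot : ∀ j < k, ∀ x, ¬ D.Inc (e j) x := fun j hj x hx => ((hDG _ _).1 hx).2 (hCe j hj)
    refine ⟨fun x f => if hf : D.Inc f x then
        s x * if 0 < a ⟨(x, f), hf⟩ then -1 else 1
      else if ∃ j < k, x = v j ∧ f = e j then s x else -s x,
      fun j hj => ?_, fun j hj => ?_, fun p => ?_⟩
    · dsimp only
      rw [dif_neg (hnot j hj _), if_pos ⟨j, hj, rfl, rfl⟩]
    · dsimp only
      rw [dif_neg (hnot j hj _), if_neg]
      rintro ⟨i, hi, h1, h2⟩
      have := h.edge_injOn (show j ∈ Set.Iio k from hj) (show i ∈ Set.Iio k from hi) h2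
      subst this
      exact (h.isLink j hj).ne h1.symm
    · dsimp only
      rw [dif_pos p.2]
  have hτk : ∀ j ≤ k, τ (v j) (e j) = s (v j) := by
    intro j hj
    rcases hj.lt_or_eq with h1 | rfl
    · exact hτ₁ j h1
    · rw [h.edge_last, h.vertex_last, hτ₁ 0 h.pos]
  have hterm : ∀ p : HalfEdge D, (τ p.1.1 p.1.2 : ℤ) * F p.1.2 = s p.1.1 * (-2 * a p) := by
    intro p
    rw [hτ, hF', Units.val_mul, mul_assoc]
    congr 1
    split_ifs with hp
    · rw [abs_of_pos hp]; push_cast; ring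
    · rw [abs_of_nonpos (not_lt.1 hp)]; push_cast; ring
  have hedge : ∀ f ∈ G.edgeSet, (∃ j < k, f = e j) ∨ ∃ p : HalfEdge D, p.1.2 = f := by
    intro f hf
    by_cases hfC : f ∈ C.edgeSet
    · exact Or.inl (h.exists_edge_eq hfC)
    · obtain ⟨x, y, hxy⟩ := G.exists_isLink_of_mem_edgeSet hf
      exact Or.inr ⟨⟨(x, f), (hDG _ _).2 ⟨hxy.inc_left, hfC⟩⟩, rfl⟩
  refine ⟨τ, F, ⟨fun f x y hxy => ?_, fun x hx => ?_, fun f hf => ?_⟩, fun f hf => ?_⟩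
  · by_cases hfC : f ∈ C.edgeSet
    · obtain ⟨j, hj, rfl⟩ := h.exists_edge_eq hfC
      rw [hs j hj]
      rcases hxy.eq_and_eq_or_eq_and_eq ((h.isLink j hj).mono hle) with ⟨rfl, rfl⟩ | ⟨rfl, rfl⟩
      · rw [hτ₁ j hj, hτ₂ j hj, mul_neg]
      · rw [hτ₁ j hj, hτ₂ j hj, neg_mul, mul_comm]
    · have hxy' : D.IsLink f x y := hD ▸ ⟨hxy, hfC⟩
      have h1 := hτ ⟨(x, f), hxy'.inc_left⟩
      have h2 := hτ ⟨(y, f), hxy'.inc_right⟩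
      have h3 := ha ⟨(x, f), hxy'.inc_left⟩
      have h4 := ha' ⟨(x, f), hxy'.inc_left⟩
      have h5 := habs ⟨(x, f), hxy'.inc_left⟩
      rw [HalfEdge.swap_eq hxy'] at h3 h4
      dsimp only at h1 h2 h3 h4
      rw [h1, h2]
      generalize a ⟨(x, f), hxy'.inc_left⟩ = b at *
      have hb : b ≠ 0 := by rintro rfl; simp at h5
      by_cases hσ : σ f = s x * s y
      · rw [h4 hσ, hσ]
        rcases lt_or_gt_of_ne hb with h6 | h6
        · simp [h6, h6.not_gt]
        · simp [h6, h6.not_gt]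
      · rw [h3 hσ, Int.units_ne_iff_eq_neg.1 hσ]
        split_ifs <;> simp
  · rw [← hC.vertexSet_eq] at hx
    obtain ⟨j, hj, rfl⟩ := h.exists_eq x hx
    have hsplit : G.incidenceSet (v (j + 1)) =
        {e j, e (j + 1)} ∪ D.incidenceSet (v (j + 1)) := by
      ext f
      simp only [Graph.mem_incidenceSet, Set.mem_union, Set.mem_insert_iff, Set.mem_singleton_iff,
        hDG, ← h.inc_iff j hj]
      by_cases hfC : f ∈ C.edgeSet
      · simp [hfC, hle.inc_congr hfC]
      · simp [hfC]
    have hdisj : Disjoint {e j, e (j + 1)} (D.incidenceSet (v (j + 1))) := by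
      rw [Set.disjoint_left]
      intro f hf hf'
      exact ((hDG _ _).1 hf').2 ((h.inc_iff j hj f).2 hf).edge_mem
    have hfin : (D.incidenceSet (v (j + 1))).Finite := hE.subset fun f hf =>
      ((hDG _ _).1 hf).1.edge_mem
    rw [boundary, hsplit, finsum_mem_union hdisj (Set.toFinite _) hfin,
      finsum_mem_pair (h.edge_ne j hj), finsum_incidenceSet, hτ₂ j hj, hτk (j + 1) hj,
      hFk j hj.le, hFk (j + 1) hj, hl j]
    have hsum : ∑ p : HalfEdge D with p.1.1 = v (j + 1), (τ (v (j + 1)) p.1.2 : ℤ) * F p.1.2 =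
        s (v (j + 1)) * (-2 * ∑ p with place p = j, a p) := by
      rw [Finset.mul_sum, Finset.mul_sum]
      refine Finset.sum_congr ?_ fun p hp => ?_
      · ext p
        simp only [Finset.mem_filter, Finset.mem_univ, true_and]
        constructor
        · intro hp
          exact h.vertex_succ_inj (hk p) hj ((hplace p).symm.trans hp)
        · intro hp
          rw [hplace p, hp]
      · have hp' : p.1.1 = v (j + 1) := by
          rw [hplace p, (Finset.mem_filter.1 hp).2]
        rw [← hp', hterm]
    rw [hsum]
    push_cast
    ring
  · rcases hedge f hf with ⟨j, hj, rfl⟩ | ⟨p, rfl⟩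
    · rw [hF j hj, abs_lt]
      have := hl' j
      push_cast
      constructor <;> omega
    · rw [hF', abs_of_nonneg (by positivity)]
      push_cast
      rcases habs p with h1 | h1 <;> omega
  · rcases hedge f hf with ⟨j, hj, rfl⟩ | ⟨p, rfl⟩
    · rw [hF j hj]
      omega
    · rw [hF']
      rcases habs p with h1 | h1 <;> omega

end SignedFlow

theorem theorem4p3 {α β : Type*} (G : Graph α β) [G.Loopless]
    (hV : G.vertexSet.Finite) (hE : G.edgeSet.Finite) (σ : β → ℤˣ)
    (hadm : SignedFlow.FlowAdmissible G σ)
    (hH : ∃ C : Graph α β, SignedFlow.IsHamiltonianCircuit G C ∧ SignedFlow.IsBalanced σ C) :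
    SignedFlow.AdmitsNZF G σ 6 := by
  classical
  obtain ⟨C, ⟨hspan, hcirc⟩, hbal⟩ := hH
  have hle : C ≤ G := hspan.le
  have : C.Loopless := Graph.Loopless.anti hle
  obtain ⟨k, v, e, h⟩ := SignedFlow.exists_isCyclicEnum hcirc (hspan.vertexSet_eq ▸ hV)
  obtain ⟨s, hs⟩ := h.exists_switching hbal
  have hDle : G.deleteEdges C.edgeSet ≤ G := Graph.deleteEdges_le
  have : (G.deleteEdges C.edgeSet).Loopless := Graph.Loopless.anti hDle
  have : Finite (SignedFlow.HalfEdge (G.deleteEdges C.edgeSet)) :=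
    SignedFlow.HalfEdge.finite hV (hE.subset hDle.edgeSet_mono)
  have := Fintype.ofFinite (SignedFlow.HalfEdge (G.deleteEdges C.edgeSet))
  have hplace : ∀ p : SignedFlow.HalfEdge (G.deleteEdges C.edgeSet), ∃ j < k, p.1.1 = v (j + 1) :=
    fun p => h.exists_eq _ (hspan.vertexSet_eq ▸ p.2.vertex_mem)
  choose place hk hplace using hplace
  have hsymm : ∀ p : SignedFlow.HalfEdge (G.deleteEdges C.edgeSet),
      σ p.1.2 ≠ s p.1.1 * s p.swap.1.1 →
        σ p.swap.1.2 ≠ s p.swap.1.1 * s p.swap.swap.1.1 := by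
    intro p hp
    rwa [SignedFlow.HalfEdge.swap_involutive, SignedFlow.HalfEdge.swap_edge, mul_comm]
  obtain ⟨a, l, hl, hl0, hl', ha, ha', habs⟩ := SignedFlow.exists_levels
    SignedFlow.HalfEdge.swap_involutive SignedFlow.HalfEdge.swap_ne
    {p | σ p.1.2 ≠ s p.1.1 * s p.swap.1.1} hsymm (fun p hp => by
      obtain ⟨f, x, y, hf, hne, hσ⟩ := SignedFlow.exists_ne_negative_edge hV hE hadm s
        (p.isLink_swap.mono hDle) hp
      -- The second negative edge is a chord, because the circuit is positive after switching.
      have hfC : f ∉ C.edgeSet := by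
        intro hfC
        obtain ⟨j, hj, rfl⟩ := h.exists_edge_eq hfC
        rw [hs j hj] at hσ
        rcases hf.eq_and_eq_or_eq_and_eq ((h.isLink j hj).mono hle) with ⟨rfl, rfl⟩ | ⟨rfl, rfl⟩
        · exact hσ rfl
        · exact hσ (mul_comm _ _)
      have hf' : (G.deleteEdges C.edgeSet).IsLink f x y := ⟨hf, hfC⟩
      refine ⟨⟨(x, f), hf'.inc_left⟩, ?_, ?_, ?_⟩
      · rw [Set.mem_ofPred_eq, SignedFlow.HalfEdge.swap_eq hf']
        exact hσ
      · rintro rfl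
        exact hne rfl
      · intro h1
        exact hne (congrArg (fun q => q.1.2) h1)) k place hk
  exact SignedFlow.admitsNZF_of_levels hspan rfl hE h s hs place hk hplace a l hl hl0 hl' ha
    (fun p hp => ha' p fun h1 => h1 hp) habs
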